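/- Let $n\ge 1$, let $H\in\mathbb R^{n\times n}$ be symmetric positive definite, $\theta^*\in\mathbb R^n$, $J^*,h_0\in\mathbb R$, $h_1\in\mathbb R^n\setminus\{0\}$, and put $$J(\theta)=J^*+\tfrac12(\theta-\theta^*)^TH(\theta-\theta^*),\qquad h(\theta)=h_0+h_1^T(\theta-\theta^*).$$ Let $k,c,\omega_{\rm f}>0$, and let $\omega_1',\dots,\omega_n'>0$ be pairwise distinct with rational ratios $\omega_i'/\omega_j'$ and $\omega_i'+\omega_j'\ne\omega_l'$ for distinct $i,j,l$. For $a,\delta,\omega>0$ put $\omega_i=\omega\,\omega_i'$, $S_i(t)=a\sin(\omega_it)$, $M_i(t)=\frac2a\sin(\omega_it)$ and $\max_\delta\{x\}=\frac12\big(x+\sqrt{x^2+\delta}\big)$, and consider for $\hat\theta,G_J,G_h\in\mathbb R^n$, $\eta_J,\eta_h,\gamma\in\mathbb R$ the system $$\begin{aligned} \dot{\hat\theta}&=-kG_J+\gamma\,\textstyle\max_\delta\{kG_J^TG_h-c\,\eta_h\}\,G_h, & \dot G_J&=-\omega_{\rm f}G_J+\omega_{\rm f}\,(J(\theta)-\eta_J)M(t),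 & \dot\eta_J&=-\omega_{\rm f}\eta_J+\omega_{\rm f}J(\theta),\\ \dot\gamma&=\omega_{\rm f}\gamma\,(1-\gamma\|G_h\|^2), & \dot G_h&=-\omega_{\rm f}G_h+\omega_{\rm f}\,(h(\theta)-\eta_h)M(t), & \dot\eta_h&=-\omega_{\rm f}\eta_h+\omega_{\rm f}h(\theta), \end{aligned}$$ where $\theta(t)=\hat\theta(t)+S(t)$. Write $\tilde x=[\hat\theta-\theta^*;G_J;\eta_J;G_h;\eta_h;\gamma]\in\mathbb R^{3n+3}$. In the time $\tau=\omega t$ the system reads $\omega\,\frac{d\tilde x}{d\tau}=f(\tilde x,\tau)$, where $f$ does not depend on $\omega$ and is periodic in $\tau$ with period $\Pi=2\pi\,\mathrm{LCM}\{1/\omega_i'\}$ (the LCM being the least positive number that is an integer multiple of every $1/\omega_i'$); its average is $f^{\rm a}(x)=\frac1\Pi\int_0^\Pi f(x,\tau)\,d\tau$. **Theorem (local convergence to the safe optimum).** The minimum $J_s^*$ of $J$ on the safe set $\{\theta:h(\theta)\ge0\}$ exists. For all $a,\delta>0$ the average field $f^{\rm a}$ has exactly one zero $x^{\rm a,e}$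 with positive $\gamma$-component, and there are $\rho,\omega^*>0$ such that for every initial state with $\|\tilde x(0)-x^{\rm a,e}\|<\rho$ and every $\omega\ge\omega^*$ the system has a solution on $[0,\infty)$, and along every such solution $J(\theta(t))$ is bounded as $t\to\infty$ and $$\limsup_{t\to\infty}J(\theta(t))=J_s^*+O\!\left(\tfrac1\omega+a+\delta\right).$$ Here $\rho,\omega^*$ may depend on $a,\delta$, while the $O$ is uniform: for every $A>0$ there is a constant $C$, independent of $a,\delta\in(0,A]$, of $\omega\geq\omega^*$ and of the initial state, such that $\big|\limsup_{t\to\infty}J(\theta(t))-J_s^*\big|\le C\,(1/\omega+a+\delta)$. -/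

import Mathlib

open Set Filter MeasureTheory
open scoped Topology InnerProductSpace Matrix

noncomputable section

namespace ASfES

/-- The parameter space `ℝⁿ` with the Euclidean norm. -/
abbrev Vec (n : ℕ) := EuclideanSpace ℝ (Fin n)

/-- The state `[θ; G_J; η_J; G_h; η_h; γ]`, of total dimension `3 n + 3`. -/
abbrev State (n : ℕ) := Vec n × Vec n × ℝ × Vec n × ℝ × ℝ

/-- The Euclidean norm of a state, seen as a vector of `ℝ^(3n+3)`
(the built-in norm of a product type is a maximum). -/
def stateNorm {n : ℕ} : State n → ℝ
  | (θ, GJ, ηJ, Gh, ηh, γ) =>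
    √(‖θ‖ ^ 2 + ‖GJ‖ ^ 2 + ηJ ^ 2 + ‖Gh‖ ^ 2 + ηh ^ 2 + γ ^ 2)

/-- The data of the problem and of the algorithm, apart from the dither amplitude `a`, the
smoothing parameter `δ` and the frequency scale `ω`. -/
structure Data (n : ℕ) where
  /-- the unconstrained minimal value `J^*` -/
  Jmin : ℝ
  /-- the Hessian of the objective -/
  H : Matrix (Fin n) (Fin n) ℝ
  /-- the unconstrained minimizer `θ^*` -/
  θmin : Vec n
  /-- the value of the barrier function at `θ^*` -/
  h₀ : ℝ
  /-- the gradient of the barrier function -/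
  h₁ : Vec n
  /-- the adaptation gain -/
  k : ℝ
  /-- the attractivity rate -/
  c : ℝ
  /-- the filter gain -/
  ωf : ℝ
  /-- the normalized frequencies `ω_i'`; the actual ones are `ω_i = ω * ω_i'` -/
  freq : Fin n → ℝ

/-- The requirements on the perturbation frequencies. -/
structure AdmissibleFreq {n : ℕ} (ν : Fin n → ℝ) : Prop where
  pos : ∀ i, 0 < ν i
  rational : ∀ i j, ∃ q : ℚ, ν i / ν j = (q : ℝ)
  ne : ∀ i j, i ≠ j → ν i ≠ ν j
  add_ne : ∀ i j l, i ≠ j → i ≠ l → j ≠ l → ν i + ν j ≠ ν l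

/-- The smoothed maximum `max_δ {x} = (x + √(x² + δ)) / 2`. -/
def smoothMax (δ x : ℝ) : ℝ := (x + √(x ^ 2 + δ)) / 2

/-- The perturbation signal `S_i(t) = a sin (ν_i t)`. -/
def dither {n : ℕ} (a : ℝ) (ν : Fin n → ℝ) (t : ℝ) : Vec n :=
  WithLp.toLp 2 fun i => a * Real.sin (ν i * t)

/-- The demodulation signal `M_i(t) = (2 / a) sin (ν_i t)`. -/
def demod {n : ℕ} (a : ℝ) (ν : Fin n → ℝ) (t : ℝ) : Vec n :=
  WithLp.toLp 2 fun i => 2 / a * Real.sin (ν i * t)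

/-- The least common multiple of a family of positive real numbers: the least positive number
that is an integer multiple of each of them. -/
def realLCM {ι : Type*} (v : ι → ℝ) : ℝ :=
  sInf {L : ℝ | 0 < L ∧ ∀ i, ∃ m : ℕ, L = m * v i}

/-- The common period `2π · LCM {1 / ν_i}` of the signals with frequencies `ν_i`. -/
def period {n : ℕ} (ν : Fin n → ℝ) : ℝ := 2 * Real.pi * realLCM fun i => 1 / ν i

namespace Data

variable {n : ℕ} (P : Data n)

/-- The objective `J(θ) = J^* + (θ - θ^*)ᵀ H (θ - θ^*) / 2`. -/
def J (θ : Vec n) : ℝ :=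
  P.Jmin + 1 / 2 * ((θ - P.θmin).ofLp ⬝ᵥ (P.H *ᵥ (θ - P.θmin).ofLp))

/-- The barrier function `h(θ) = h₀ + h₁ᵀ (θ - θ^*)`. -/
def h (θ : Vec n) : ℝ := P.h₀ + ⟪P.h₁, θ - P.θmin⟫_ℝ

/-- The safe set `{h ≥ 0}`. -/
def safeSet : Set (Vec n) := {θ | 0 ≤ P.h θ}

/-- The right-hand side of the algorithm when the signals `S`, `M` have the values `s`, `m`. -/
def rhs (δ : ℝ) (s m : Vec n) : State n → State n
  | (θ, GJ, ηJ, Gh, ηh, γ) =>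
    (-(P.k • GJ) + (γ * smoothMax δ (P.k * ⟪GJ, Gh⟫_ℝ - P.c * ηh)) • Gh,
     -(P.ωf • GJ) + (P.ωf * (P.J (θ + s) - ηJ)) • m,
     -(P.ωf * ηJ) + P.ωf * P.J (θ + s),
     -(P.ωf • Gh) + (P.ωf * (P.h (θ + s) - ηh)) • m,
     -(P.ωf * ηh) + P.ωf * P.h (θ + s),
     P.ωf * γ * (1 - γ * ‖Gh‖ ^ 2))

/-- The signal frequencies `ω_i = ω * ω_i'`. -/
def scaledFreq (ω : ℝ) : Fin n → ℝ := fun i => ω * P.freq i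

/-- `x = [θhat; G_J; η_J; G_h; η_h; γ]` solves the differential equations of the algorithm on
`[0, ∞)`, with frequencies `ω * ω_i'`. -/
def IsSolution (a δ ω : ℝ) (x : ℝ → State n) : Prop :=
  ∀ t ∈ Ici (0 : ℝ), HasDerivWithinAt x
    (P.rhs δ (dither a (P.scaledFreq ω) t) (demod a (P.scaledFreq ω) t) (x t)) (Ici 0) t

/-- The parameter `θ(t) = θhat(t) + S(t)` at which the maps are evaluated. -/
def param (a ω : ℝ) (x : ℝ → State n) (t : ℝ) : Vec n :=
  (x t).1 + dither a (P.scaledFreq ω) t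

/-- From the estimation error `θtilde = θhat - θ^*` back to the estimate `θhat`; the other
components of the state are unchanged. -/
def ofError : State n → State n
  | (θ, r) => (θ + P.θmin, r)

/-- The right-hand side `f(xtilde, τ)` in the error coordinates and in the time `τ = ω t`
(up to the factor `1 / ω`). -/
def errorField (a δ τ : ℝ) (x : State n) : State n :=
  P.rhs δ (dither a P.freq τ) (demod a P.freq τ) (P.ofError x)

/-- The average of `f(x, τ)` over one period in `τ`. -/
def avgField (a δ : ℝ) (x : State n) : State n :=
  (period P.freq)⁻¹ • ∫ τ in (0 : ℝ)..period P.freq, P.errorField a δ τ x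

/-- `x` is an equilibrium of the average system with positive `γ`-component. -/
def IsAvgEquilibrium (a δ : ℝ) (x : State n) : Prop :=
  P.avgField a δ x = 0 ∧ 0 < x.2.2.2.2.2

end Data

end ASfES

end

/-!
The system is an averaging scheme: over one period the demodulated measurements `(J - η_J) M` and
`(h - η_h) M` have the means `∇J(θhat)` and `∇h = h₁`, so the average field is a filtered, smoothed
safe gradient flow (`Data.avgField_eq`). Only the products of two sines contribute; products of
three sines are odd and have mean zero whatever the resonances.

*The equilibrium.* At a zero of the average field with positive `γ` one has `G_h = h₁`,
`γ = 1 / ‖h₁‖²` and `θhat - θ^* = μ H⁻¹ h₁`, where `μ > 0` solves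
`μ (h₀ + μ D) = δ / (4 k c ‖h₁‖²)` with `D = h₁ᵀ H⁻¹ h₁` (`Data.exists_eq_eqPoint`). This is a
relaxed complementary slackness condition; it has one positive root, whose square differs by `O(δ)`
from the square of the multiplier `μ₀ = max 0 (-h₀ / D)` of the constrained problem
(`abs_sq_sub_sq_le`). As `J = J^* + μ² D / 2` at these points, the value of `J` at the equilibrium
is within `O(δ)` of the safe minimum, even when `h₀ = 0` and `μ` itself is only `O(√δ)`.

*Stability.* The linearization at the equilibrium is a cascade. Its core is a second order system
`θ'' + ω_f θ' + ω_f M θ = 0`, where `M` is the product of the symmetric positive definite maps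
`1 - σ h₁ h₁ᵀ / ‖h₁‖²` and `k H + c σ / ((1 - σ) ‖h₁‖²) h₁ h₁ᵀ`, and `σ ∈ (0, 1)` is the slope of
the smoothed maximum; all the other blocks are pure decays. Hence there is a quadratic Lyapunov
function (`Data.hasQuadraticLyapunov_fderiv_gradField`).

*Averaging.* A solution of the fast system moves over one period `T` like one step of length `T` of
the average system, up to `O(T²)`. For small `T` this error is beaten by the decrease of the
Lyapunov function, so a sublevel set is invariant at the times `k T`, and solutions exist forever
and stay as close to the equilibrium as desired (`exists_stability_of_average`). The initial radius
and the frequency threshold may depend on `a`, so one may ask for closeness `a`. Then `θ(t)` is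
within `O(a)` of the equilibrium value for all times, and `J(θ(t))` is within `O(a + δ)` of the safe
minimum.
-/

noncomputable section

namespace ASfES

/-! ### Linear maps with a quadratic Lyapunov function -/

section QuadraticLyapunov

variable {E F : Type*} [NormedAddCommGroup E] [NormedSpace ℝ E] [NormedAddCommGroup F]
  [NormedSpace ℝ F]

/-- The linear system `x' = A x` has a strict quadratic Lyapunov function `x ↦ B x x`. -/
def HasQuadraticLyapunov (A : E →L[ℝ] E) : Prop :=
  ∃ B : E →L[ℝ] E →L[ℝ] ℝ, (∀ x y, B x y = B y x) ∧ (∀ x, x ≠ 0 → 0 < B x x) ∧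
    ∀ x, x ≠ 0 → B x (A x) < 0

lemma exists_coercive_of_pos [FiniteDimensional ℝ E] {q : E → ℝ} (hq : Continuous q)
    (hhom : ∀ (c : ℝ) x, q (c • x) = c ^ 2 * q x) (hpos : ∀ x, x ≠ 0 → 0 < q x) :
    ∃ m : ℝ, 0 < m ∧ ∀ x, m * ‖x‖ ^ 2 ≤ q x := by
  have h0 : q 0 = 0 := by simpa using hhom 0 0
  rcases subsingleton_or_nontrivial E with hE | hE
  · refine ⟨1, one_pos, fun x => ?_⟩
    rw [Subsingleton.elim x 0, h0]; simp
  · have : ProperSpace E := FiniteDimensional.proper_real E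
    obtain ⟨z, hz, hmin⟩ := (isCompact_sphere (0 : E) 1).exists_isMinOn
      (NormedSpace.sphere_nonempty.2 zero_le_one) hq.continuousOn
    have hz0 : z ≠ 0 := by
      rintro rfl
      simp at hz
    refine ⟨q z, hpos z hz0, fun x => ?_⟩
    by_cases hx : x = 0
    · rw [hx, h0]; simp
    have hx' : 0 < ‖x‖ := norm_pos_iff.2 hx
    have h1 : q z ≤ q (‖x‖⁻¹ • x) := hmin (by simp [norm_smul, hx'.ne'])
    rw [hhom] at h1
    calc q z * ‖x‖ ^ 2 ≤ (‖x‖⁻¹ ^ 2 * q x) * ‖x‖ ^ 2 := by gcongr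
      _ = q x := by field_simp

lemma HasQuadraticLyapunov.exists_bounds [FiniteDimensional ℝ E] {A : E →L[ℝ] E}
    (hA : HasQuadraticLyapunov A) :
    ∃ (B : E →L[ℝ] E →L[ℝ] ℝ) (m : ℝ), 0 < m ∧ (∀ x y, B x y = B y x) ∧
      (∀ x, m * ‖x‖ ^ 2 ≤ B x x) ∧ ∀ x, B x (A x) ≤ -(m * ‖x‖ ^ 2) := by
  obtain ⟨B, hs, hp, hn⟩ := hA
  obtain ⟨m₁, hm₁, h₁⟩ := exists_coercive_of_pos (q := fun x => B x x) (by fun_prop)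
    (fun c x => by simp; ring) hp
  obtain ⟨m₂, hm₂, h₂⟩ := exists_coercive_of_pos (q := fun x => -B x (A x)) (by fun_prop)
    (fun c x => by simp; ring) (fun x hx => by have := hn x hx; linarith)
  refine ⟨B, min m₁ m₂, lt_min hm₁ hm₂, hs, fun x => ?_, fun x => ?_⟩
  · exact (mul_le_mul_of_nonneg_right (min_le_left _ _) (sq_nonneg _)).trans (h₁ x)
  · have := (mul_le_mul_of_nonneg_right (min_le_right m₁ m₂) (sq_nonneg ‖x‖)).trans (h₂ x)
    linarith

/-- Pull-back along an injective semiconjugacy. The target may be larger than the source, so that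
redundant coordinates are allowed. -/
lemma HasQuadraticLyapunov.of_semiconj {A : E →L[ℝ] E} {A' : F →L[ℝ] F}
    (hA' : HasQuadraticLyapunov A') (L : E →L[ℝ] F) (hL : ∀ x, L x = 0 → x = 0)
    (h : ∀ x, L (A x) = A' (L x)) : HasQuadraticLyapunov A := by
  obtain ⟨B, hs, hp, hn⟩ := hA'
  refine ⟨B.bilinearComp L L, fun x y => ?_, fun x hx => ?_, fun x hx => ?_⟩
  · simpa using hs (L x) (L y)
  · simpa using hp (L x) (fun h0 => hx (hL x h0))
  · simpa [h] using hn (L x) (fun h0 => hx (hL x h0))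

/-- A cascade `x' = A₁ x + C y`, `y' = A₂ y` of two such systems: `B₁ + l B₂` works for large `l`,
whatever the coupling `C`. -/
lemma HasQuadraticLyapunov.cascade [FiniteDimensional ℝ E] [FiniteDimensional ℝ F]
    {A₁ : E →L[ℝ] E} {A₂ : F →L[ℝ] F} (h₁ : HasQuadraticLyapunov A₁)
    (h₂ : HasQuadraticLyapunov A₂) (C : F →L[ℝ] E) :
    HasQuadraticLyapunov ((A₁.comp (.fst ℝ E F) + C.comp (.snd ℝ E F)).prod
      (A₂.comp (.snd ℝ E F))) := by
  obtain ⟨B₁, m₁, hm₁, hs₁, hp₁, hn₁⟩ := h₁.exists_bounds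
  obtain ⟨B₂, m₂, hm₂, hs₂, hp₂, hn₂⟩ := h₂.exists_bounds
  set b : ℝ := ‖B₁‖ * ‖C‖ with hb
  set l : ℝ := (b ^ 2 + 1) / (m₁ * m₂) with hl
  have hlpos : 0 < l := by positivity
  have hlm : l * m₂ * m₁ = b ^ 2 + 1 := by rw [hl]; field_simp
  have hnorm : ∀ z : E × F, z ≠ 0 → 0 < ‖z.1‖ ^ 2 + ‖z.2‖ ^ 2 := by
    rintro ⟨x, y⟩ hz
    by_contra! hle
    have hx : ‖x‖ ^ 2 = 0 := le_antisymm (by have := sq_nonneg ‖y‖; simp at hle; linarith)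
      (sq_nonneg _)
    have hy : ‖y‖ ^ 2 = 0 := le_antisymm (by have := sq_nonneg ‖x‖; simp at hle; linarith)
      (sq_nonneg _)
    apply hz
    simpa using And.intro hx hy
  refine ⟨B₁.bilinearComp (.fst ℝ E F) (.fst ℝ E F)
    + l • B₂.bilinearComp (.snd ℝ E F) (.snd ℝ E F), ?_, ?_, ?_⟩
  · intro z w
    simp [hs₁ z.1 w.1, hs₂ z.2 w.2]
  · intro z hz
    have h := hnorm z hz
    have h1 := hp₁ z.1
    have h2 := mul_le_mul_of_nonneg_left (hp₂ z.2) hlpos.le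
    simp only [add_apply, smul_apply,
      ContinuousLinearMap.bilinearComp_apply, ContinuousLinearMap.coe_fst',
      ContinuousLinearMap.coe_snd', smul_eq_mul]
    have : 0 < m₁ * ‖z.1‖ ^ 2 + l * (m₂ * ‖z.2‖ ^ 2) := by
      rcases (sq_nonneg ‖z.1‖).eq_or_lt with h0 | h0
      · have : 0 < ‖z.2‖ ^ 2 := by linarith
        rw [← h0]; positivity
      · positivity
    linarith
  · intro z hz
    have h := hnorm z hz
    have h1 := hn₁ z.1
    have h2 := mul_le_mul_of_nonneg_left (hn₂ z.2) hlpos.le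
    have h3 : B₁ z.1 (C z.2) ≤ b * (‖z.1‖ * ‖z.2‖) := by
      calc B₁ z.1 (C z.2) ≤ ‖B₁ z.1 (C z.2)‖ := Real.le_norm_self _
        _ ≤ ‖B₁‖ * ‖z.1‖ * ‖C z.2‖ := B₁.le_opNorm₂ _ _
        _ ≤ ‖B₁‖ * ‖z.1‖ * (‖C‖ * ‖z.2‖) := by gcongr; exact C.le_opNorm _
        _ = b * (‖z.1‖ * ‖z.2‖) := by rw [hb]; ring
    simp only [add_apply, smul_apply,
      ContinuousLinearMap.bilinearComp_apply, ContinuousLinearMap.coe_fst',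
      ContinuousLinearMap.coe_snd', smul_eq_mul, ContinuousLinearMap.prod_apply,
      ContinuousLinearMap.comp_apply, map_add]
    set X := ‖z.1‖
    set Y := ‖z.2‖
    -- complete the square in `m₁ X² - b X Y + l m₂ Y²`, after multiplication by `m₁`
    have key : 0 < m₁ * (m₁ * X ^ 2 - b * (X * Y) + l * (m₂ * Y ^ 2)) := by
      have e : m₁ * (m₁ * X ^ 2 - b * (X * Y) + l * (m₂ * Y ^ 2))
          = (m₁ * X - b * Y / 2) ^ 2 + (3 / 4 * b ^ 2 + 1) * Y ^ 2 := by
        have : m₁ * (l * (m₂ * Y ^ 2)) = (l * m₂ * m₁) * Y ^ 2 := by ring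
        linear_combination this + Y ^ 2 * hlm
      rw [e]
      rcases (sq_nonneg Y).eq_or_lt with h0 | h0
      · have hY : Y = 0 := by simpa using h0.symm
        have hX : 0 < X ^ 2 := by linarith
        rw [hY]
        have : 0 < m₁ ^ 2 * X ^ 2 := by positivity
        nlinarith
      · positivity
    have := pos_of_mul_pos_right key hm₁.le
    linarith

end QuadraticLyapunov

section InnerProduct

variable {E : Type*} [NormedAddCommGroup E] [InnerProductSpace ℝ E]

/-- The bilinear form `(x, y) ↦ ⟪T x, y⟫`. -/
def innerForm (T : E →L[ℝ] E) : E →L[ℝ] E →L[ℝ] ℝ := (innerSL ℝ).comp T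

@[simp] lemma innerForm_apply (T : E →L[ℝ] E) (x y : E) : innerForm T x y = ⟪T x, y⟫_ℝ := rfl

lemma hasQuadraticLyapunov_neg_smul_id {w : ℝ} (hw : 0 < w) :
    HasQuadraticLyapunov (-(w • ContinuousLinearMap.id ℝ E)) := by
  refine ⟨innerForm (.id ℝ E), fun x y => by simp [real_inner_comm], fun x hx => ?_, fun x hx => ?_⟩
  · simpa only [innerForm_apply, ContinuousLinearMap.id_apply] using real_inner_self_pos.2 hx
  · have : 0 < ‖x‖ ^ 2 := by positivity
    simp [inner_neg_right, inner_smul_right]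
    positivity

/-- The second order system `θ'' + w θ' + w M θ = 0` with `v = -θ'`. If `R` and `R M` are
symmetric and positive then so is the form
`w ⟪R M θ, θ⟫ + ⟪R (v - w/2 θ), v - w/2 θ⟫ + w²/4 ⟪R θ, θ⟫`, and its derivative along the flow is
`-w ⟪R v, v⟫ - w² ⟪R M θ, θ⟫`. -/
lemma hasQuadraticLyapunov_secondOrder {w : ℝ} (hw : 0 < w) {M R Q : E →L[ℝ] E}
    (hQ : ∀ x, R (M x) = Q x)
    (hRs : ∀ x y, ⟪R x, y⟫_ℝ = ⟪x, R y⟫_ℝ) (hRp : ∀ x, x ≠ 0 → 0 < ⟪R x, x⟫_ℝ)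
    (hQs : ∀ x y, ⟪Q x, y⟫_ℝ = ⟪x, Q y⟫_ℝ) (hQp : ∀ x, x ≠ 0 → 0 < ⟪Q x, x⟫_ℝ) :
    HasQuadraticLyapunov ((-ContinuousLinearMap.snd ℝ E E).prod
      (-(w • ContinuousLinearMap.snd ℝ E E) + w • M.comp (.fst ℝ E E))) := by
  set D : E × E →L[ℝ] E := .snd ℝ E E - (w / 2) • .fst ℝ E E with hD
  have hRs' : ∀ x y, ⟪R x, y⟫_ℝ = ⟪R y, x⟫_ℝ := fun x y => by rw [hRs, real_inner_comm]
  have hQs' : ∀ x y, ⟪Q x, y⟫_ℝ = ⟪Q y, x⟫_ℝ := fun x y => by rw [hQs, real_inner_comm]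
  have hRn : ∀ x, 0 ≤ ⟪R x, x⟫_ℝ := fun x => by
    rcases eq_or_ne x 0 with rfl | hx
    · simp
    · exact (hRp x hx).le
  have hQn : ∀ x, 0 ≤ ⟪Q x, x⟫_ℝ := fun x => by
    rcases eq_or_ne x 0 with rfl | hx
    · simp
    · exact (hQp x hx).le
  refine ⟨w • (innerForm Q).bilinearComp (.fst ℝ E E) (.fst ℝ E E)
    + (innerForm R).bilinearComp D D
    + (w ^ 2 / 4) • (innerForm R).bilinearComp (.fst ℝ E E) (.fst ℝ E E), ?_, ?_, ?_⟩
  · rintro x y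
    simp [hQs' x.1 y.1, hRs' x.1 y.1, hRs' (D x) (D y)]
  · rintro ⟨θ, v⟩ hz
    simp only [add_apply, smul_apply,
      ContinuousLinearMap.bilinearComp_apply, ContinuousLinearMap.coe_fst',
      innerForm_apply, smul_eq_mul]
    rcases eq_or_ne θ 0 with rfl | hθ
    · have hv : v ≠ 0 := by rintro rfl; exact hz rfl
      have : D (0, v) = v := by simp [hD]
      rw [this]
      simpa using hRp v hv
    · have h1 := hQp θ hθ
      have h2 := hRn (D (θ, v))
      have h3 := hRn θ
      positivity
  · rintro ⟨θ, v⟩ hz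
    have e : w * ⟪Q θ, -v⟫_ℝ + ⟪R (v - (w / 2) • θ), (-(w • v) + w • M θ) - (w / 2) • (-v)⟫_ℝ
        + w ^ 2 / 4 * ⟪R θ, -v⟫_ℝ = -(w / 2 * ⟪R v, v⟫_ℝ + w ^ 2 / 2 * ⟪Q θ, θ⟫_ℝ) := by
      have e1 : ⟪R v, M θ⟫_ℝ = ⟪Q θ, v⟫_ℝ := by rw [hRs, hQ, real_inner_comm]
      have e2 : ⟪R θ, M θ⟫_ℝ = ⟪Q θ, θ⟫_ℝ := by rw [hRs, hQ, real_inner_comm]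
      simp only [map_sub, map_smul, inner_neg_right, inner_sub_left, inner_sub_right,
        inner_add_right, inner_smul_left, inner_smul_right, e1, e2, RCLike.conj_to_real]
      ring
    simp only [add_apply, smul_apply,
      ContinuousLinearMap.bilinearComp_apply, ContinuousLinearMap.coe_fst',
      innerForm_apply, smul_eq_mul, ContinuousLinearMap.prod_apply,
      neg_apply, ContinuousLinearMap.coe_snd',
      ContinuousLinearMap.comp_apply, hD, sub_apply]
    rw [e, neg_lt_zero]
    rcases eq_or_ne θ 0 with rfl | hθ
    · have hv : v ≠ 0 := by rintro rfl; exact hz rfl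
      have := hRp v hv
      have := hQn (0 : E)
      positivity
    · have := hQp θ hθ
      have := hRn v
      positivity

end InnerProduct

/-! ### Averaging over one period -/

section Averaging

variable {E : Type*} [NormedAddCommGroup E] [NormedSpace ℝ E]

/-- A field bounded by `M` on a ball cannot move an integral curve out of that ball in a time
shorter than half the radius divided by `M`. -/
lemma norm_sub_le_of_isIntegralCurveOn {v : ℝ → E → E} {c : E} {R M s T : ℝ} {x : ℝ → E}
    (hM : ∀ t, ∀ y ∈ Metric.closedBall c R, ‖v t y‖ < M) (hM0 : 0 < M) (hT : M * T ≤ R / 2)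
    (hx : IsIntegralCurveOn x v (Icc s (s + T))) (hs : ‖x s - c‖ ≤ R / 2) :
    ∀ t ∈ Icc s (s + T), ‖x t - x s‖ ≤ M * (t - s) := by
  have hder : ∀ t ∈ Ico s (s + T),
      HasDerivWithinAt (fun t => x t - x s) (v t (x t)) (Ici t) t := by
    intro t ht
    have h1 := (hx t (Ico_subset_Icc_self ht)).mono (t := Icc s (s + T)) (s := Icc t (s + T))
      (Icc_subset_Icc_left ht.1)
    exact (h1.mono_of_mem_nhdsWithin (Icc_mem_nhdsGE ht.2)).sub_const _
  have hcont : ContinuousOn (fun t => x t - x s) (Icc s (s + T)) :=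
    hx.continuousOn.sub continuousOn_const
  intro t ht
  refine image_norm_le_of_norm_deriv_right_lt_deriv_boundary' (B := fun t => M * (t - s))
    (B' := fun _ => M) hcont hder (by simp) (by fun_prop) (fun t _ => ?_) ?_ ht
  · simpa using (((hasDerivAt_id t).sub_const s).const_mul M).hasDerivWithinAt
  · intro t ht he
    refine hM t _ ?_
    have h2 : M * (t - s) ≤ M * T := by
      have := ht.2.le
      gcongr
      linarith
    rw [mem_closedBall_iff_norm]
    calc ‖x t - c‖ = ‖(x t - x s) + (x s - c)‖ := by congr 1; abel
      _ ≤ ‖x t - x s‖ + ‖x s - c‖ := norm_add_le _ _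
      _ ≤ R := by linarith [he.le]

/-- Over a time `T`, an integral curve moves as if its state were frozen, up to `O(T²)`. -/
lemma norm_sub_integral_frozen_le [CompleteSpace E] {v : ℝ → E → E} {c : E} {R M s T : ℝ}
    {K : NNReal}
    {x : ℝ → E} (hv : Continuous (Function.uncurry v))
    (hM : ∀ t, ∀ y ∈ Metric.closedBall c R, ‖v t y‖ < M) (hM0 : 0 < M)
    (hK : ∀ t, LipschitzOnWith K (v t) (Metric.closedBall c R))
    (hT0 : 0 ≤ T) (hT : M * T ≤ R / 2)
    (hx : IsIntegralCurveOn x v (Icc s (s + T))) (hs : ‖x s - c‖ ≤ R / 2) :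
    ‖(x (s + T) - x s) - ∫ t in s..s + T, v t (x s)‖ ≤ K * M * T ^ 2 := by
  have hle : s ≤ s + T := by linarith
  have hmove := norm_sub_le_of_isIntegralCurveOn hM hM0 hT hx hs
  have hMT : 0 ≤ M * T := by positivity
  have hmoveT : ∀ t ∈ Icc s (s + T), ‖x t - x s‖ ≤ M * T := fun t ht =>
    (hmove t ht).trans (by have := ht.2; gcongr; linarith)
  have hball : ∀ t ∈ Icc s (s + T), x t ∈ Metric.closedBall c R := by
    intro t ht
    rw [mem_closedBall_iff_norm]
    calc ‖x t - c‖ = ‖(x t - x s) + (x s - c)‖ := by congr 1; abel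
      _ ≤ ‖x t - x s‖ + ‖x s - c‖ := norm_add_le _ _
      _ ≤ R := by linarith [hmoveT t ht]
  have hc1 : ContinuousOn (fun t => v t (x t)) (Icc s (s + T)) :=
    hv.comp_continuousOn (continuousOn_id.prodMk hx.continuousOn)
  have hc2 : Continuous (fun t => v t (x s)) := by
    exact hv.comp (by fun_prop : Continuous fun t : ℝ => (t, x s))
  have hi1 : IntervalIntegrable (fun t => v t (x t)) volume s (s + T) :=
    ContinuousOn.intervalIntegrable (by rwa [uIcc_of_le hle])
  have hint : ∫ t in s..s + T, v t (x t) = x (s + T) - x s := by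
    refine intervalIntegral.integral_eq_sub_of_hasDerivAt_of_le hle hx.continuousOn
      (fun t ht => ?_) hi1
    exact (hx t (Ioo_subset_Icc_self ht)).hasDerivAt (Icc_mem_nhds ht.1 ht.2)
  rw [← hint, ← intervalIntegral.integral_sub hi1 (hc2.intervalIntegrable _ _)]
  have := intervalIntegral.norm_integral_le_of_norm_le_const (a := s) (b := s + T)
    (f := fun t => v t (x t) - v t (x s)) (C := K * (M * T)) (fun t ht => by
      rw [uIoc_of_le hle] at ht
      have ht' := Ioc_subset_Icc_self ht
      calc ‖v t (x t) - v t (x s)‖ ≤ K * ‖x t - x s‖ :=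
            (hK t).norm_sub_le (hball t ht') (hball s (left_mem_Icc.2 hle))
        _ ≤ K * (M * T) := by gcongr; exact hmoveT t ht')
  refine this.trans (le_of_eq ?_)
  rw [add_sub_cancel_left, abs_of_nonneg hT0]
  ring

/-- One step of the discrete Lyapunov argument: a sublevel set of the quadratic form is invariant
under steps `d` that agree with `T g` up to `O(T²)` when `g` points strictly inwards. -/
lemma quadratic_step_le {B : E →L[ℝ] E →L[ℝ] ℝ} (hB : ∀ x y, B x y = B y x)
    {z d g : E} {T κ K M R l : ℝ} (hκ : 0 < κ) (hK : 0 ≤ K) (hM : 0 ≤ M) (hT : 0 ≤ T) (hT1 : T ≤ 1)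
    (hz : ‖z‖ ≤ R) (hd : ‖d‖ ≤ M * T) (hdg : ‖d - T • g‖ ≤ K * M * T ^ 2)
    (hg : B z g ≤ -(κ * ‖z‖ ^ 2)) (hl : B z z ≤ l)
    (hsmall : (‖B‖ * (2 * ‖B‖ * R * K * M + ‖B‖ * M ^ 2) / (2 * κ)
      + (2 * ‖B‖ * R * K * M + ‖B‖ * M ^ 2)) * T ≤ l) :
    B (z + d) (z + d) ≤ l := by
  set C := 2 * ‖B‖ * R * K * M + ‖B‖ * M ^ 2 with hC
  have hR : 0 ≤ R := (norm_nonneg z).trans hz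
  have hC0 : 0 ≤ C := by positivity
  have h1 : B z (d - T • g) ≤ ‖B‖ * R * (K * M * T ^ 2) :=
    calc B z (d - T • g) ≤ ‖B z (d - T • g)‖ := Real.le_norm_self _
      _ ≤ ‖B‖ * ‖z‖ * ‖d - T • g‖ := B.le_opNorm₂ _ _
      _ ≤ ‖B‖ * R * (K * M * T ^ 2) := by gcongr
  have h2 : B d d ≤ ‖B‖ * (M * T) * (M * T) :=
    calc B d d ≤ ‖B d d‖ := Real.le_norm_self _
      _ ≤ ‖B‖ * ‖d‖ * ‖d‖ := B.le_opNorm₂ _ _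
      _ ≤ ‖B‖ * (M * T) * (M * T) := by gcongr
  have h3 : B z z ≤ ‖B‖ * ‖z‖ ^ 2 :=
    calc B z z ≤ ‖B z z‖ := Real.le_norm_self _
      _ ≤ ‖B‖ * ‖z‖ * ‖z‖ := B.le_opNorm₂ _ _
      _ = ‖B‖ * ‖z‖ ^ 2 := by ring
  have h4 : B (z + d) (z + d) = B z z + 2 * (T * B z g + B z (d - T • g)) + B d d := by
    simp only [map_add, add_apply, map_sub, map_smul, smul_eq_mul]
    rw [hB d z]; ring
  have h5 : B (z + d) (z + d) ≤ B z z + T * (C * T - 2 * κ * ‖z‖ ^ 2) := by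
    have h6 : T * B z g ≤ T * -(κ * ‖z‖ ^ 2) := mul_le_mul_of_nonneg_left hg hT
    rw [h4, hC]
    linarith
  rcases le_total (C * T) (2 * κ * ‖z‖ ^ 2) with h | h
  · have : T * (C * T - 2 * κ * ‖z‖ ^ 2) ≤ 0 :=
      mul_nonpos_of_nonneg_of_nonpos hT (by linarith)
    linarith
  · have h7 : ‖z‖ ^ 2 ≤ C * T / (2 * κ) := by
      rw [le_div_iff₀ (by positivity)]; linarith
    have h8 : T * (C * T - 2 * κ * ‖z‖ ^ 2) ≤ 1 * (C * T) := by
      apply mul_le_mul hT1 _ (by linarith) zero_le_one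
      have : 0 ≤ 2 * κ * ‖z‖ ^ 2 := by positivity
      linarith
    have h9 : ‖B‖ * ‖z‖ ^ 2 ≤ ‖B‖ * (C * T / (2 * κ)) := by gcongr
    have h10 : ‖B‖ * (C * T / (2 * κ)) = ‖B‖ * C / (2 * κ) * T := by ring
    linarith

lemma integral_comp_mul_period {F : ℝ → E} {p : ℝ} (hper : Function.Periodic F p)
    {ω : ℝ} (hω : 0 < ω) (k : ℕ) :
    ∫ t in (k * (p / ω))..(k * (p / ω) + p / ω), F (ω * t) = ω⁻¹ • ∫ τ in (0 : ℝ)..p, F τ := by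
  rw [intervalIntegral.integral_comp_mul_left _ hω.ne']
  have e1 : ω * (k * (p / ω)) = k * p := by field_simp
  have e2 : ω * (k * (p / ω) + p / ω) = k * p + p := by field_simp
  rw [e1, e2, hper.intervalIntegral_add_eq _ 0, zero_add]

lemma isIntegralCurveOn_Icc_glue {v : ℝ → E → E} {x y : ℝ → E} {a b c : ℝ} (hab : a ≤ b)
    (hbc : b ≤ c) (hx : IsIntegralCurveOn x v (Icc a b)) (hy : IsIntegralCurveOn y v (Icc b c))
    (hxy : x b = y b) :
    IsIntegralCurveOn (fun t => if t ≤ b then x t else y t) v (Icc a c) := by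
  intro t ht
  set w : ℝ → E := fun t => if t ≤ b then x t else y t with hw
  have hwx : ∀ s ≤ b, w s = x s := fun s hs => by simp [hw, hs]
  have hwy : ∀ s, b ≤ s → w s = y s := fun s hs => by
    rcases hs.eq_or_lt with rfl | h
    · simp [hw, hxy]
    · simp [hw, not_le.2 h]
  have hl : t ≤ b → HasDerivWithinAt w (v t (w t)) (Icc a b) t := fun h => by
    rw [hwx t h]
    exact (hx t ⟨ht.1, h⟩).congr (fun s hs => hwx s hs.2) (hwx t h)
  have hr : b ≤ t → HasDerivWithinAt w (v t (w t)) (Icc b c) t := fun h => by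
    rw [hwy t h]
    exact (hy t ⟨h, ht.2⟩).congr (fun s hs => hwy s hs.1) (hwy t h)
  rcases lt_trichotomy t b with h | h | h
  · exact (hl h.le).mono_of_mem_nhdsWithin
      (mem_of_superset (inter_mem_nhdsWithin _ (Iio_mem_nhds h)) fun s hs => ⟨hs.1.1, hs.2.le⟩)
  · have := (hl h.le).union (hr h.ge)
    rwa [Icc_union_Icc_eq_Icc hab hbc] at this
  · exact (hr h.le).mono_of_mem_nhdsWithin
      (mem_of_superset (inter_mem_nhdsWithin _ (Ioi_mem_nhds h)) fun s hs => ⟨hs.2.le, hs.1.2⟩)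

/-- Solutions on all the intervals `[0, k T]`, unique there, patch to a solution on `[0, ∞)`. -/
lemma exists_isIntegralCurveOn_Ici {v : ℝ → E → E} {x₀ : E} {T : ℝ} (hT : 0 < T)
    (hex : ∀ k : ℕ, ∃ x : ℝ → E, IsIntegralCurveOn x v (Icc 0 (k * T)) ∧ x 0 = x₀)
    (huniq : ∀ (k : ℕ) (x y : ℝ → E), IsIntegralCurveOn x v (Icc 0 (k * T)) → x 0 = x₀ →
      IsIntegralCurveOn y v (Icc 0 (k * T)) → y 0 = x₀ → EqOn x y (Icc 0 (k * T))) :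
    ∃ x : ℝ → E, IsIntegralCurveOn x v (Ici 0) ∧ x 0 = x₀ := by
  choose X hX hX0 using hex
  have hmono : ∀ {j k : ℕ}, j ≤ k → EqOn (X j) (X k) (Icc 0 (j * T)) := fun {j k} hjk => by
    refine huniq j _ _ (hX j) (hX0 j) ((hX k).mono (Icc_subset_Icc_right ?_)) (hX0 k)
    gcongr
  -- at time `t` use the solution on `[0, k T]` for some `k` with `t < k T`
  set κ : ℝ → ℕ := fun t => ⌊t / T⌋₊ + 1 with hκ
  have hlt : ∀ t, t < κ t * T := fun t => by
    have := Nat.lt_floor_add_one (t / T)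
    rw [div_lt_iff₀ hT] at this
    simpa [hκ] using this
  have heq : ∀ (k : ℕ) (t : ℝ), 0 ≤ t → t ≤ k * T → X (κ t) t = X k t := fun k t h0 h1 => by
    rcases le_total (κ t) k with h | h
    · exact hmono h ⟨h0, (hlt t).le⟩
    · exact (hmono h ⟨h0, h1⟩).symm
  refine ⟨fun t => X (κ t) t, fun t ht => ?_, by simpa using hX0 (κ 0)⟩
  have ht0 : (0 : ℝ) ≤ t := ht
  have hd := hX (κ t) t ⟨ht0, (hlt t).le⟩
  have hd' : HasDerivWithinAt (X (κ t)) (v t (X (κ t) t)) (Ici 0) t :=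
    hd.mono_of_mem_nhdsWithin (mem_of_superset (inter_mem_nhdsWithin _ (Iio_mem_nhds (hlt t)))
      fun s hs => ⟨hs.1, hs.2.le⟩)
  refine hd'.congr_of_eventuallyEq ?_ rfl
  filter_upwards [inter_mem_nhdsWithin (Ici 0) (Iio_mem_nhds (hlt t))] with s hs
  exact heq (κ t) s hs.1 (le_of_lt hs.2)

lemma exists_inward_of_hasFDerivAt {f : E → E} {c : E} {A : E →L[ℝ] E} (hf : HasFDerivAt f A c)
    (h0 : f c = 0) {B : E →L[ℝ] E →L[ℝ] ℝ} {m : ℝ} (hm : 0 < m)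
    (hB : ∀ x, B x (A x) ≤ -(m * ‖x‖ ^ 2)) :
    ∃ R : ℝ, 0 < R ∧ ∀ z, ‖z‖ ≤ R → B z (f (c + z)) ≤ -(m / 2 * ‖z‖ ^ 2) := by
  have hη : 0 < m / (2 * (‖B‖ + 1)) := by positivity
  obtain ⟨R, hR, h⟩ := Metric.eventually_nhds_iff_ball.1 (hf.isLittleO.def hη)
  refine ⟨R / 2, by positivity, fun z hz => ?_⟩
  have h1 := h (c + z) (by rw [mem_ball_iff_norm, add_sub_cancel_left]; linarith)
  rw [h0, sub_zero, add_sub_cancel_left] at h1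
  have h2 : B z (f (c + z) - A z) ≤ m / 2 * ‖z‖ ^ 2 :=
    calc B z (f (c + z) - A z) ≤ ‖B z (f (c + z) - A z)‖ := Real.le_norm_self _
      _ ≤ ‖B‖ * ‖z‖ * ‖f (c + z) - A z‖ := B.le_opNorm₂ _ _
      _ ≤ (‖B‖ + 1) * ‖z‖ * (m / (2 * (‖B‖ + 1)) * ‖z‖) := by gcongr; linarith
      _ = m / 2 * ‖z‖ ^ 2 := by field_simp
  rw [map_sub] at h2
  linarith [hB z]

lemma exists_norm_lt_of_periodic [FiniteDimensional ℝ E] {F : ℝ → E → E} {p : ℝ} (hp : 0 < p)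
    (hF : Continuous (Function.uncurry F)) (hper : ∀ y, Function.Periodic (fun τ => F τ y) p)
    (c : E) (R : ℝ) :
    ∃ M : ℝ, 0 < M ∧ ∀ τ, ∀ y ∈ Metric.closedBall c R, ‖F τ y‖ < M := by
  have : ProperSpace E := FiniteDimensional.proper_real E
  obtain ⟨M, hM⟩ := ((isCompact_Icc (a := (0 : ℝ)) (b := p)).prod
    (isCompact_closedBall c R)).exists_bound_of_continuousOn hF.continuousOn
  refine ⟨|M| + 1, by positivity, fun τ y hy => ?_⟩
  obtain ⟨σ, hσ, he⟩ := (hper y).exists_mem_Ico₀ hp τ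
  have h1 := hM (σ, y) ⟨Ico_subset_Icc_self hσ, hy⟩
  have he' : F τ y = F σ y := he
  rw [he']
  have h2 : ‖F σ y‖ ≤ M := h1
  linarith [le_abs_self M]

/-- **Practical stability by averaging.** If the average of the periodic field `F` vanishes at `c`
and its linearization there has a quadratic Lyapunov function, then for fast oscillations the
solutions of `x' = F (ω t) x` that start near `c` exist forever and stay near `c`. -/
theorem exists_stability_of_average [FiniteDimensional ℝ E] {F : ℝ → E → E} {p : ℝ} (hp : 0 < p)
    (hF : Continuous (Function.uncurry F)) (hper : ∀ y, Function.Periodic (fun τ => F τ y) p)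
    {c : E} (hlip : ∀ R, ∃ K : NNReal, ∀ τ, LipschitzOnWith K (F τ) (Metric.closedBall c R))
    (h0 : p⁻¹ • ∫ τ in (0 : ℝ)..p, F τ c = 0) {A : E →L[ℝ] E}
    (hA : HasFDerivAt (fun y => p⁻¹ • ∫ τ in (0 : ℝ)..p, F τ y) A c)
    (hst : HasQuadraticLyapunov A) {ε : ℝ} (hε : 0 < ε) :
    ∃ ρ ωs : ℝ, 0 < ρ ∧ 0 < ωs ∧ ∀ x₀, ‖x₀ - c‖ < ρ → ∀ ω, ωs ≤ ω →
      (∃ x : ℝ → E, IsIntegralCurveOn x (fun t => F (ω * t)) (Ici 0) ∧ x 0 = x₀) ∧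
      ∀ x : ℝ → E, IsIntegralCurveOn x (fun t => F (ω * t)) (Ici 0) → x 0 = x₀ →
        ∀ t, 0 ≤ t → ‖x t - c‖ ≤ ε := by
  have : CompleteSpace E := FiniteDimensional.complete ℝ E
  obtain ⟨B, m, hm, hBs, hBp, hBn⟩ := hst.exists_bounds
  obtain ⟨R₀, hR₀, hin⟩ := exists_inward_of_hasFDerivAt hA h0 hm hBn
  set R := min R₀ ε with hRdef
  have hR : 0 < R := lt_min hR₀ hε
  obtain ⟨M, hM0, hM⟩ := exists_norm_lt_of_periodic hp hF hper c R
  obtain ⟨K, hK⟩ := hlip R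
  -- the sublevel set `B z z ≤ l` lies in the ball of radius `R / 2`
  set l : ℝ := m * (R / 2) ^ 2 with hl
  have hl0 : 0 < l := by positivity
  set C₀ : ℝ := ‖B‖ * (2 * ‖B‖ * R * K * M + ‖B‖ * M ^ 2) / (2 * (m / 2))
      + (2 * ‖B‖ * R * K * M + ‖B‖ * M ^ 2) with hC₀
  have hC₀0 : 0 ≤ C₀ := by positivity
  set T₀ : ℝ := min 1 (min (R / 2 / M) (l / (C₀ + 1))) with hT₀
  have hT₀0 : 0 < T₀ := by positivity
  refine ⟨√(l / (‖B‖ + 1)), p / T₀, by positivity, by positivity, fun x₀ hx₀ ω hω => ?_⟩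
  have hω0 : 0 < ω := lt_of_lt_of_le (by positivity) hω
  set T := p / ω with hT
  have hT0 : 0 < T := by positivity
  have hTT : T ≤ T₀ := by
    rw [hT, div_le_iff₀ hω0]
    rwa [div_le_iff₀ hT₀0, mul_comm] at hω
  have hT1 : T ≤ 1 := hTT.trans (min_le_left _ _)
  have hTM : M * T ≤ R / 2 := by
    have : T ≤ R / 2 / M := hTT.trans ((min_le_right _ _).trans (min_le_left _ _))
    rwa [le_div_iff₀ hM0, mul_comm] at this
  have hTC : C₀ * T ≤ l := by
    have : T ≤ l / (C₀ + 1) := hTT.trans ((min_le_right _ _).trans (min_le_right _ _))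
    rw [le_div_iff₀ (by positivity)] at this
    nlinarith
  set v : ℝ → E → E := fun t => F (ω * t) with hv
  have hvc : Continuous (Function.uncurry v) := by
    have : Function.uncurry v = Function.uncurry F ∘ fun q : ℝ × E => (ω * q.1, q.2) := by
      ext ⟨t, y⟩; rfl
    rw [this]
    exact hF.comp (by fun_prop)
  have hvM : ∀ t, ∀ y ∈ Metric.closedBall c R, ‖v t y‖ < M := fun t => hM _
  have hvK : ∀ t, LipschitzOnWith K (v t) (Metric.closedBall c R) := fun t => hK _
  have hsub : ∀ z, B z z ≤ l → ‖z‖ ≤ R / 2 := fun z hz => by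
    have h1 : m * ‖z‖ ^ 2 ≤ m * (R / 2) ^ 2 := (hBp z).trans hz
    exact (pow_le_pow_iff_left₀ (norm_nonneg z) (by positivity) two_ne_zero).1
      (le_of_mul_le_mul_left h1 hm)
  have hx₀l : B (x₀ - c) (x₀ - c) ≤ l := by
    have h1 : ‖x₀ - c‖ ^ 2 ≤ l / (‖B‖ + 1) := by
      rw [← Real.sq_sqrt (by positivity : 0 ≤ l / (‖B‖ + 1))]
      gcongr
    rw [le_div_iff₀ (by positivity)] at h1
    calc B (x₀ - c) (x₀ - c) ≤ ‖B (x₀ - c) (x₀ - c)‖ := Real.le_norm_self _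
      _ ≤ ‖B‖ * ‖x₀ - c‖ * ‖x₀ - c‖ := B.le_opNorm₂ _ _
      _ ≤ ‖x₀ - c‖ ^ 2 * (‖B‖ + 1) := by nlinarith [sq_nonneg ‖x₀ - c‖]
      _ ≤ l := h1
  -- one period, started in the sublevel set
  have hstep : ∀ (k : ℕ) (x : ℝ → E), IsIntegralCurveOn x v (Icc (k * T) (k * T + T)) →
      B (x (k * T) - c) (x (k * T) - c) ≤ l →
      (∀ t ∈ Icc (k * T) (k * T + T), ‖x t - c‖ ≤ R) ∧
        B (x (k * T + T) - c) (x (k * T + T) - c) ≤ l := by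
    intro k x hx hxl
    have hz := hsub _ hxl
    have hmove := norm_sub_le_of_isIntegralCurveOn hvM hM0 hTM hx hz
    refine ⟨fun t ht => ?_, ?_⟩
    · have h1 : M * (t - k * T) ≤ M * T := by
        have := ht.2
        gcongr
        linarith
      calc ‖x t - c‖ = ‖(x t - x (k * T)) + (x (k * T) - c)‖ := by congr 1; abel
        _ ≤ ‖x t - x (k * T)‖ + ‖x (k * T) - c‖ := norm_add_le _ _
        _ ≤ R := by linarith [hmove t ht]
    · have hfro := norm_sub_integral_frozen_le hvc hvM hM0 hvK hT0.le hTM hx hz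
      have hint : ∫ t in (k * T)..(k * T + T), v t (x (k * T))
          = T • p⁻¹ • ∫ τ in (0 : ℝ)..p, F τ (x (k * T)) := by
        rw [hv, hT]
        rw [integral_comp_mul_period (hper _) hω0 k, smul_smul]
        congr 1
        field_simp
      rw [hint] at hfro
      have hg := hin (x (k * T) - c) (hz.trans (by
        have := min_le_left R₀ ε
        linarith))
      rw [add_sub_cancel] at hg
      have hd := hmove (k * T + T) (right_mem_Icc.2 (by linarith))
      rw [add_sub_cancel_left] at hd
      have := quadratic_step_le hBs (half_pos hm) K.2 hM0.le hT0.le hT1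
        (hz.trans (by linarith : R / 2 ≤ R)) hd hfro hg hxl hTC
      have e : x (k * T) - c + (x (k * T + T) - x (k * T)) = x (k * T + T) - c := by abel
      rwa [e] at this
  have hapriori : ∀ (k : ℕ) (x : ℝ → E), IsIntegralCurveOn x v (Icc 0 (k * T)) → x 0 = x₀ →
      (∀ t ∈ Icc 0 (k * T), ‖x t - c‖ ≤ R) ∧ B (x (k * T) - c) (x (k * T) - c) ≤ l := by
    intro k
    induction k with
    | zero =>
      intro x _ hx0
      have hx₀R := hsub _ hx₀l
      constructor
      · intro t ht
        have ht0 : t = 0 := by simpa using ht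
        rw [ht0, hx0]
        linarith
      · simpa [hx0] using hx₀l
    | succ k ih =>
      intro x hx hx0
      have hk : ((k + 1 : ℕ) : ℝ) * T = k * T + T := by push_cast; ring
      have hkT : 0 ≤ k * T := by positivity
      rw [hk] at hx ⊢
      obtain ⟨h1, h2⟩ := ih x (hx.mono (Icc_subset_Icc_right (by linarith))) hx0
      obtain ⟨h3, h4⟩ := hstep k x (hx.mono (Icc_subset_Icc_left hkT)) h2
      refine ⟨fun t ht => ?_, h4⟩
      rcases le_total t (k * T) with h | h
      · exact h1 t ⟨ht.1, h⟩
      · exact h3 t ⟨h, ht.2⟩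
  have hexist : ∀ k : ℕ, ∃ x : ℝ → E, IsIntegralCurveOn x v (Icc 0 (k * T)) ∧ x 0 = x₀ := by
    intro k
    induction k with
    | zero =>
      refine ⟨fun _ => x₀, fun t ht => ?_, rfl⟩
      have hs : Icc (0 : ℝ) ((0 : ℕ) * T) = {0} := by simp
      rw [hs] at ht ⊢
      rw [mem_singleton_iff.1 ht]
      exact hasDerivWithinAt_iff_hasFDerivWithinAt.2 .singleton
    | succ k ih =>
      obtain ⟨x, hx, hx0⟩ := ih
      have hk : ((k + 1 : ℕ) : ℝ) * T = k * T + T := by push_cast; ring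
      have hkT : 0 ≤ k * T := by positivity
      have hz := hsub _ (hapriori k x hx hx0).2
      have hle : k * T ≤ k * T + T := by linarith
      have hsubball : Metric.closedBall (x (k * T)) (R / 2) ⊆ Metric.closedBall c R :=
        Metric.closedBall_subset_closedBall' (by rw [dist_eq_norm]; linarith)
      have hPL : IsPicardLindelof v (tmin := k * T) (tmax := k * T + T)
          ⟨k * T, left_mem_Icc.2 hle⟩ (x (k * T)) (R / 2).toNNReal 0 M.toNNReal K := by
        have hRc : ((R / 2).toNNReal : ℝ) = R / 2 := Real.coe_toNNReal _ (by positivity)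
        have hMc : (M.toNNReal : ℝ) = M := Real.coe_toNNReal _ hM0.le
        refine ⟨fun t _ => ?_, fun y _ => ?_, fun t _ y hy => ?_, ?_⟩
        · rw [hRc]; exact (hvK t).mono hsubball
        · exact (hvc.comp (by fun_prop : Continuous fun t : ℝ => (t, y))).continuousOn
        · rw [hRc] at hy
          rw [hMc]
          exact (hvM t y (hsubball hy)).le
        · rw [hRc, hMc]
          simpa [hT0.le] using hTM
      obtain ⟨y, hy0, hy⟩ := hPL.exists_eq_forall_mem_Icc_hasDerivWithinAt₀
      refine ⟨fun t => if t ≤ k * T then x t else y t, ?_, ?_⟩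
      · rw [hk]
        exact isIntegralCurveOn_Icc_glue hkT hle hx hy hy0.symm
      · simp [hkT, hx0]
  refine ⟨exists_isIntegralCurveOn_Ici hT0 hexist fun k x y hx hx0 hy hy0 => ?_,
    fun x hx hx0 t ht => ?_⟩
  · have hright : ∀ {w : ℝ → E}, IsIntegralCurveOn w v (Icc 0 (k * T)) →
        ∀ t ∈ Ico 0 (k * T), HasDerivWithinAt w (v t (w t)) (Ici t) t := fun {w} hw t ht =>
      ((hw t (Ico_subset_Icc_self ht)).mono (Icc_subset_Icc_left ht.1)).mono_of_mem_nhdsWithin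
        (Icc_mem_nhdsGE ht.2)
    exact ODE_solution_unique_of_mem_Icc_right (s := fun _ => Metric.closedBall c R)
      (fun t _ => hvK t) hx.continuousOn (hright hx)
      (fun t ht => mem_closedBall_iff_norm.2 ((hapriori k x hx hx0).1 t (Ico_subset_Icc_self ht)))
      hy.continuousOn (hright hy)
      (fun t ht => mem_closedBall_iff_norm.2 ((hapriori k y hy hy0).1 t (Ico_subset_Icc_self ht)))
      (hx0.trans hy0.symm)
  · have hk : t ≤ (⌈t / T⌉₊ : ℝ) * T := by
      rw [← div_le_iff₀ hT0]; exact Nat.le_ceil _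
    exact ((hapriori _ x (hx.mono Icc_subset_Ici_self) hx0).1 t ⟨ht, hk⟩).trans (min_le_right _ _)

end Averaging

/-! ### The perturbation signals -/

section Signals

variable {n : ℕ} {ν : Fin n → ℝ}

/-- The rationality of the ratios makes the set of common multiples nonempty; it is discrete, so
its infimum is attained. -/
lemma AdmissibleFreq.realLCM_mem (hν : AdmissibleFreq ν) (i₀ : Fin n) :
    0 < realLCM (fun i => 1 / ν i) ∧ ∀ i, ∃ m : ℕ, realLCM (fun i => 1 / ν i) = m * (1 / ν i) := by
  classical
  set S : Set ℝ := {L : ℝ | 0 < L ∧ ∀ i, ∃ m : ℕ, L = m * (1 / ν i)} with hS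
  have hν₀ := hν.pos i₀
  have hne : ∃ k : ℕ, (k : ℝ) * (1 / ν i₀) ∈ S := by
    choose q hq using fun i => hν.rational i i₀
    have hq0 : ∀ i, 0 < q i := fun i => by
      have := div_pos (hν.pos i) hν₀
      rw [hq i] at this
      exact_mod_cast this
    refine ⟨∏ i, (q i).den, by
      have : 0 < ∏ i, (q i).den := Finset.prod_pos fun i _ => (q i).den_pos
      positivity, fun i => ?_⟩
    obtain ⟨r, hr⟩ := Finset.dvd_prod_of_mem (fun i => (q i).den) (Finset.mem_univ i)
    refine ⟨r * (q i).num.toNat, ?_⟩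
    have hnum : (((q i).num.toNat : ℕ) : ℝ) = (q i).num := by
      have := Int.toNat_of_nonneg (Rat.num_pos.2 (hq0 i)).le
      exact_mod_cast congrArg (fun z : ℤ => (z : ℝ)) this
    have hden : ((q i).den : ℝ) ≠ 0 := by exact_mod_cast (q i).den_ne_zero
    have hνi : ν i = (q i).num / (q i).den * ν i₀ := by
      have h1 : ((q i : ℚ) : ℝ) = (q i).num / (q i).den := Rat.cast_def _
      rw [← h1, ← hq i]
      field_simp
    have hνi0 := (hν.pos i).ne'
    rw [hr]
    push_cast
    rw [hnum]
    have e : ((q i).num : ℝ) = ν i * (q i).den / ν i₀ := by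
      rw [hνi]; field_simp
    rw [e]
    field_simp
  set k := Nat.find hne with hk
  have hmem : (k : ℝ) * (1 / ν i₀) ∈ S := Nat.find_spec hne
  have hleast : IsLeast S ((k : ℝ) * (1 / ν i₀)) := by
    refine ⟨hmem, fun L hL => ?_⟩
    obtain ⟨j, hj⟩ := hL.2 i₀
    have : k ≤ j := Nat.find_min' hne (by rw [← hj]; exact hL)
    rw [hj]
    have : (k : ℝ) ≤ j := by exact_mod_cast this
    gcongr
  have : realLCM (fun i => 1 / ν i) = (k : ℝ) * (1 / ν i₀) := hleast.csInf_eq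
  rw [this]
  exact hmem

lemma AdmissibleFreq.period_pos (hν : AdmissibleFreq ν) (i₀ : Fin n) : 0 < period ν := by
  have := (hν.realLCM_mem i₀).1
  have := Real.pi_pos
  unfold period
  positivity

lemma AdmissibleFreq.freq_mul_period (hν : AdmissibleFreq ν) (i₀ : Fin n) (i : Fin n) :
    ∃ m : ℕ, ν i * period ν = m * (2 * Real.pi) := by
  obtain ⟨m, hm⟩ := (hν.realLCM_mem i₀).2 i
  refine ⟨m, ?_⟩
  have := (hν.pos i).ne'
  rw [period, hm]
  field_simp

lemma AdmissibleFreq.sin_add_period (hν : AdmissibleFreq ν) (i₀ : Fin n) (i : Fin n) (τ : ℝ) :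
    Real.sin (ν i * (τ + period ν)) = Real.sin (ν i * τ) := by
  obtain ⟨m, hm⟩ := hν.freq_mul_period i₀ i
  rw [mul_add, hm, Real.sin_add_nat_mul_two_pi]

lemma AdmissibleFreq.dither_periodic (hν : AdmissibleFreq ν) (i₀ : Fin n) (a : ℝ) :
    Function.Periodic (dither a ν) (period ν) := fun τ => by
  simp only [dither, hν.sin_add_period i₀]

lemma AdmissibleFreq.demod_periodic (hν : AdmissibleFreq ν) (i₀ : Fin n) (a : ℝ) :
    Function.Periodic (demod a ν) (period ν) := fun τ => by
  simp only [demod, hν.sin_add_period i₀]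

lemma dither_neg (a : ℝ) (ν : Fin n → ℝ) (τ : ℝ) : dither a ν (-τ) = -dither a ν τ := by
  ext i; simp [dither]

lemma demod_neg (a : ℝ) (ν : Fin n → ℝ) (τ : ℝ) : demod a ν (-τ) = -demod a ν τ := by
  ext i; simp [demod]

@[fun_prop]
lemma continuous_dither (a : ℝ) (ν : Fin n → ℝ) : Continuous (dither a ν) := by
  unfold dither
  fun_prop

@[fun_prop]
lemma continuous_demod (a : ℝ) (ν : Fin n → ℝ) : Continuous (demod a ν) := by
  unfold demod
  fun_prop

lemma norm_toLp_mul_sin_le (b : ℝ) (hb : 0 ≤ b) (ν : Fin n → ℝ) (τ : ℝ) :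
    ‖(WithLp.toLp 2 fun i => b * Real.sin (ν i * τ) : Vec n)‖ ≤ √n * b := by
  rw [EuclideanSpace.norm_eq, ← Real.sqrt_sq hb, ← Real.sqrt_mul (Nat.cast_nonneg n)]
  apply Real.sqrt_le_sqrt
  calc ∑ i, ‖√(b ^ 2) * Real.sin (ν i * τ)‖ ^ 2 ≤ ∑ _i : Fin n, b ^ 2 := by
        refine Finset.sum_le_sum fun i _ => ?_
        rw [Real.norm_eq_abs, sq_abs, mul_pow, Real.sq_sqrt (sq_nonneg b)]
        exact mul_le_of_le_one_right (sq_nonneg b) (Real.sin_sq_le_one _)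
    _ = n * b ^ 2 := by simp

lemma norm_dither_le {a : ℝ} (ha : 0 ≤ a) (ν : Fin n → ℝ) (τ : ℝ) : ‖dither a ν τ‖ ≤ √n * a :=
  norm_toLp_mul_sin_le a ha ν τ

lemma norm_demod_le {a : ℝ} (ha : 0 ≤ a) (ν : Fin n → ℝ) (τ : ℝ) :
    ‖demod a ν τ‖ ≤ √n * (2 / a) :=
  norm_toLp_mul_sin_le (2 / a) (by positivity) ν τ

/-- An odd periodic function has mean zero. This removes the products of an odd number of sines,
whatever resonances there may be among the frequencies. -/
lemma integral_eq_zero_of_odd_periodic {E : Type*} [NormedAddCommGroup E] [NormedSpace ℝ E]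
    {g : ℝ → E} {p : ℝ} (hodd : ∀ τ, g (-τ) = -g τ) (hper : Function.Periodic g p) :
    ∫ τ in (0 : ℝ)..p, g τ = 0 := by
  have h1 : ∫ τ in (0 : ℝ)..p, g (p - τ) = ∫ τ in (0 : ℝ)..p, g τ := by
    rw [intervalIntegral.integral_comp_sub_left]; simp
  have h2 : ∀ τ, g (p - τ) = -g τ := fun τ => by
    rw [← hodd, ← hper (-τ)]; congr 1; ring
  simp only [h2, intervalIntegral.integral_neg] at h1
  have h3 : (2 : ℝ) • ∫ τ in (0 : ℝ)..p, g τ = 0 := by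
    rw [two_smul]
    nth_rewrite 1 [← h1]
    simp
  exact (smul_eq_zero.1 h3).resolve_left two_ne_zero

lemma integral_cos_of_mul_eq {b p : ℝ} (hb : b ≠ 0) {m : ℤ} (h : b * p = m * (2 * Real.pi)) :
    ∫ τ in (0 : ℝ)..p, Real.cos (b * τ) = 0 := by
  rw [intervalIntegral.integral_comp_mul_left (fun y => Real.cos y) hb, integral_cos, h]
  have : Real.sin (m * (2 * Real.pi)) = 0 := by
    have := Real.sin_int_mul_pi (m * 2)
    rw [← this]; push_cast; ring_nf
  simp [this]

lemma AdmissibleFreq.integral_sin_mul_sin (hν : AdmissibleFreq ν) (i j : Fin n) :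
    ∫ τ in (0 : ℝ)..period ν, Real.sin (ν i * τ) * Real.sin (ν j * τ)
      = if i = j then period ν / 2 else 0 := by
  obtain ⟨mi, hi⟩ := hν.freq_mul_period i i
  obtain ⟨mj, hj⟩ := hν.freq_mul_period i j
  have hprod : ∀ τ, Real.sin (ν i * τ) * Real.sin (ν j * τ)
      = 1 / 2 * (Real.cos ((ν i - ν j) * τ) - Real.cos ((ν i + ν j) * τ)) := fun τ => by
    rw [sub_mul, add_mul, Real.cos_sub, Real.cos_add]; ring
  have hadd : ν i + ν j ≠ 0 := (add_pos (hν.pos i) (hν.pos j)).ne'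
  have h2 : ∫ τ in (0 : ℝ)..period ν, Real.cos ((ν i + ν j) * τ) = 0 :=
    integral_cos_of_mul_eq hadd (m := mi + mj) (by rw [add_mul, hi, hj]; push_cast; ring)
  simp only [hprod]
  rw [intervalIntegral.integral_const_mul, intervalIntegral.integral_sub
    (Continuous.intervalIntegrable (by fun_prop) _ _)
    (Continuous.intervalIntegrable (by fun_prop) _ _), h2]
  split_ifs with hij
  · subst hij
    simp
    ring
  · rw [integral_cos_of_mul_eq (sub_ne_zero.2 (hν.ne i j hij)) (m := mi - mj)
      (by rw [sub_mul, hi, hj]; push_cast; ring)]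
    simp

/-- Demodulation recovers a gradient: the mean of `⟪w, S⟫ M` is `w`. -/
lemma AdmissibleFreq.integral_inner_dither_smul_demod (hν : AdmissibleFreq ν) {a : ℝ} (ha : a ≠ 0)
    (w : Vec n) :
    ∫ τ in (0 : ℝ)..period ν, ⟪w, dither a ν τ⟫_ℝ • demod a ν τ = period ν • w := by
  ext i
  have hc : Continuous fun τ => ⟪w, dither a ν τ⟫_ℝ • demod a ν τ := by fun_prop
  have h1 := (EuclideanSpace.proj i : Vec n →L[ℝ] ℝ).intervalIntegral_comp_comm
    (hc.intervalIntegrable (μ := volume) 0 (period ν))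
  refine h1.symm.trans ?_
  have h2 : ∀ τ, (⟪w, dither a ν τ⟫_ℝ • demod a ν τ).ofLp i
      = ∑ j, 2 * w j * (Real.sin (ν j * τ) * Real.sin (ν i * τ)) := fun τ => by
    simp only [dither, demod, PiLp.inner_apply, PiLp.smul_apply, smul_eq_mul, Finset.sum_mul,
      RCLike.inner_apply, RCLike.conj_to_real]
    refine Finset.sum_congr rfl fun j _ => ?_
    field_simp
  simp only [PiLp.proj_apply, h2]
  rw [intervalIntegral.integral_finsetSum
    (fun j _ => Continuous.intervalIntegrable (by fun_prop) _ _)]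
  simp only [intervalIntegral.integral_const_mul, hν.integral_sin_mul_sin]
  simp
  ring

end Signals

/-! ### The average system in closed form -/

lemma intervalIntegral_prodMk {E F : Type*} [NormedAddCommGroup E] [NormedSpace ℝ E]
    [CompleteSpace E] [NormedAddCommGroup F] [NormedSpace ℝ F] [CompleteSpace F]
    {f : ℝ → E} {g : ℝ → F} (hf : Continuous f) (hg : Continuous g) (a b : ℝ) :
    ∫ τ in a..b, (f τ, g τ) = (∫ τ in a..b, f τ, ∫ τ in a..b, g τ) := by
  have hi := (hf.prodMk hg).intervalIntegrable (μ := volume) a b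
  have h1 := (ContinuousLinearMap.fst ℝ E F).intervalIntegral_comp_comm hi
  have h2 := (ContinuousLinearMap.snd ℝ E F).intervalIntegral_comp_comm hi
  exact Prod.ext h1.symm h2.symm

namespace Data

variable {n : ℕ} (P : Data n)

/-- The Hessian of the objective as a continuous linear map. -/
def hess : Vec n →L[ℝ] Vec n := Matrix.toEuclideanCLM (𝕜 := ℝ) P.H

variable {P}

lemma J_eq (θ : Vec n) :
    P.J θ = P.Jmin + 1 / 2 * ⟪P.hess (θ - P.θmin), θ - P.θmin⟫_ℝ := by
  generalize hx : θ - P.θmin = x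
  rw [J, hess, EuclideanSpace.inner_eq_star_dotProduct, hx]
  simp

lemma inner_hess_comm (hH : P.H.PosDef) (x y : Vec n) : ⟪P.hess x, y⟫_ℝ = ⟪x, P.hess y⟫_ℝ := by
  have hsym : P.Hᵀ = P.H := by
    have := hH.isHermitian.eq
    rwa [Matrix.conjTranspose_eq_transpose_of_trivial] at this
  rw [hess, EuclideanSpace.inner_eq_star_dotProduct, EuclideanSpace.inner_eq_star_dotProduct]
  simp only [star_trivial, Matrix.ofLp_toEuclideanCLM]
  rw [Matrix.dotProduct_mulVec, ← Matrix.mulVec_transpose, hsym]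

lemma inner_hess_pos (hH : P.H.PosDef) (x : Vec n) (hx : x ≠ 0) : 0 < ⟪P.hess x, x⟫_ℝ := by
  have h := hH.dotProduct_mulVec_pos (x := x.ofLp) (by simpa using hx)
  rw [hess, EuclideanSpace.inner_eq_star_dotProduct]
  simpa using h

lemma J_add (hH : P.H.PosDef) (θ s : Vec n) :
    P.J (θ + P.θmin + s) = P.Jmin + 1 / 2 * ⟪P.hess θ, θ⟫_ℝ + ⟪P.hess θ, s⟫_ℝ
      + 1 / 2 * ⟪P.hess s, s⟫_ℝ := by
  have e : θ + P.θmin + s - P.θmin = θ + s := by abel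
  rw [J_eq, e, map_add, inner_add_left, inner_add_right, inner_add_right, inner_hess_comm hH s θ,
    real_inner_comm _ s]
  ring

lemma h_add (θ s : Vec n) :
    P.h (θ + P.θmin + s) = P.h₀ + ⟪P.h₁, θ⟫_ℝ + ⟪P.h₁, s⟫_ℝ := by
  have e : θ + P.θmin + s - P.θmin = θ + s := by abel
  rw [h, e, inner_add_right]; ring

@[fun_prop]
lemma continuous_J : Continuous P.J := by
  have : P.J = fun θ => P.Jmin + 1 / 2 * ⟪P.hess (θ - P.θmin), θ - P.θmin⟫_ℝ := funext J_eq
  rw [this]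
  fun_prop

@[fun_prop]
lemma continuous_h : Continuous P.h := by
  unfold h
  fun_prop

variable (P)

/-- The mean of the part of `J` that is quadratic in the perturbation. It only enters the `η_J`
component of the average system. -/
def ditherMean (a : ℝ) : ℝ :=
  (period P.freq)⁻¹ * ∫ τ in (0 : ℝ)..period P.freq,
    1 / 2 * ⟪P.hess (dither a P.freq τ), dither a P.freq τ⟫_ℝ

/-- The average system in closed form: the demodulated signals are replaced by the gradients of
`J` and `h`, and `η_J` is offset by the constant `e`. -/
def gradField (e δ : ℝ) : State n → State n
  | (θ, GJ, ηJ, Gh, ηh, γ) =>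
    (-(P.k • GJ) + (γ * smoothMax δ (P.k * ⟪GJ, Gh⟫_ℝ - P.c * ηh)) • Gh,
     P.ωf • (P.hess θ - GJ),
     P.ωf * (P.Jmin + 1 / 2 * ⟪P.hess θ, θ⟫_ℝ + e - ηJ),
     P.ωf • (P.h₁ - Gh),
     P.ωf * (P.h₀ + ⟪P.h₁, θ⟫_ℝ - ηh),
     P.ωf * γ * (1 - γ * ‖Gh‖ ^ 2))

variable {P}

lemma integral_inner_dither (hfreq : AdmissibleFreq P.freq) (i₀ : Fin n) (a : ℝ) (w : Vec n) :
    ∫ τ in (0 : ℝ)..period P.freq, ⟪w, dither a P.freq τ⟫_ℝ = 0 :=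
  integral_eq_zero_of_odd_periodic (fun τ => by rw [dither_neg, inner_neg_right])
    (fun τ => by simp only [hfreq.dither_periodic i₀ a τ])

lemma integral_J_dither (hfreq : AdmissibleFreq P.freq) (i₀ : Fin n) (hH : P.H.PosDef)
    (a : ℝ) (θ : Vec n) :
    ∫ τ in (0 : ℝ)..period P.freq, P.J (θ + P.θmin + dither a P.freq τ)
      = period P.freq * (P.Jmin + 1 / 2 * ⟪P.hess θ, θ⟫_ℝ + P.ditherMean a) := by
  have hp := (hfreq.period_pos i₀).ne'
  simp only [J_add hH]
  rw [intervalIntegral.integral_add (Continuous.intervalIntegrable (by fun_prop) _ _)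
    (Continuous.intervalIntegrable (by fun_prop) _ _),
    intervalIntegral.integral_add (Continuous.intervalIntegrable (by fun_prop) _ _)
    (Continuous.intervalIntegrable (by fun_prop) _ _), integral_inner_dither hfreq i₀,
    intervalIntegral.integral_const, ditherMean]
  simp only [smul_eq_mul]
  field_simp
  ring

lemma integral_h_dither (hfreq : AdmissibleFreq P.freq) (i₀ : Fin n) (a : ℝ) (θ : Vec n) :
    ∫ τ in (0 : ℝ)..period P.freq, P.h (θ + P.θmin + dither a P.freq τ)
      = period P.freq * (P.h₀ + ⟪P.h₁, θ⟫_ℝ) := by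
  simp only [h_add]
  rw [intervalIntegral.integral_add (Continuous.intervalIntegrable (by fun_prop) _ _)
    (Continuous.intervalIntegrable (by fun_prop) _ _), integral_inner_dither hfreq i₀,
    intervalIntegral.integral_const]
  simp

/-- Only the part of the signal `y` that is linear in the dither survives the demodulation; the
rest of `y` is even. -/
lemma integral_smul_demod (hfreq : AdmissibleFreq P.freq) (i₀ : Fin n) {a : ℝ}
    (ha : a ≠ 0) (w : Vec n) {u : Vec n → ℝ} (hu : Continuous u)
    (heven : ∀ s, u (-s) = u s) :
    ∫ τ in (0 : ℝ)..period P.freq, (⟪w, dither a P.freq τ⟫_ℝ + u (dither a P.freq τ)) •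
      demod a P.freq τ = period P.freq • w := by
  simp only [add_smul]
  rw [intervalIntegral.integral_add (Continuous.intervalIntegrable (by fun_prop) _ _)
    (Continuous.intervalIntegrable (by fun_prop) _ _),
    hfreq.integral_inner_dither_smul_demod ha,
    integral_eq_zero_of_odd_periodic
      (fun τ => by rw [dither_neg, demod_neg, heven, smul_neg])
      (fun τ => by simp only [hfreq.dither_periodic i₀ a τ, hfreq.demod_periodic i₀ a τ]), add_zero]

lemma avgField_eq (hfreq : AdmissibleFreq P.freq) (i₀ : Fin n) (hH : P.H.PosDef)
    {a : ℝ} (ha : a ≠ 0) (δ : ℝ) :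
    P.avgField a δ = P.gradField (P.ditherMean a) δ := by
  funext x
  obtain ⟨θ, GJ, ηJ, Gh, ηh, γ⟩ := x
  have hp := (hfreq.period_pos i₀).ne'
  simp only [avgField, errorField, ofError, rhs]
  have hJM : ∫ τ in (0 : ℝ)..period P.freq,
      (P.ωf * (P.J (θ + P.θmin + dither a P.freq τ) - ηJ)) • demod a P.freq τ
      = period P.freq • P.ωf • P.hess θ := by
    rw [← integral_smul_demod hfreq i₀ ha (P.ωf • P.hess θ)
      (u := fun s => P.ωf * (P.Jmin + 1 / 2 * ⟪P.hess θ, θ⟫_ℝ + 1 / 2 * ⟪P.hess s, s⟫_ℝ - ηJ))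
      (by fun_prop) (by simp)]
    congr 1; funext τ; congr 1
    rw [J_add hH, inner_smul_left, RCLike.conj_to_real]; ring
  have hhM : ∫ τ in (0 : ℝ)..period P.freq,
      (P.ωf * (P.h (θ + P.θmin + dither a P.freq τ) - ηh)) • demod a P.freq τ
      = period P.freq • P.ωf • P.h₁ := by
    rw [← integral_smul_demod hfreq i₀ ha (P.ωf • P.h₁)
      (u := fun _ => P.ωf * (P.h₀ + ⟪P.h₁, θ⟫_ℝ - ηh)) (by fun_prop) (by simp)]
    congr 1; funext τ; congr 1
    rw [h_add, inner_smul_left, RCLike.conj_to_real]; ring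
  rw [intervalIntegral_prodMk (by fun_prop) (by fun_prop),
    intervalIntegral_prodMk (by fun_prop) (by fun_prop),
    intervalIntegral_prodMk (by fun_prop) (by fun_prop),
    intervalIntegral_prodMk (by fun_prop) (by fun_prop),
    intervalIntegral_prodMk (by fun_prop) (by fun_prop)]
  rw [intervalIntegral.integral_add (Continuous.intervalIntegrable (by fun_prop) _ _)
    (Continuous.intervalIntegrable (by fun_prop) _ _),
    intervalIntegral.integral_add (Continuous.intervalIntegrable (by fun_prop) _ _)
    (Continuous.intervalIntegrable (by fun_prop) _ _), hJM,
    intervalIntegral.integral_add (Continuous.intervalIntegrable (by fun_prop) _ _)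
    (Continuous.intervalIntegrable (by fun_prop) _ _),
    intervalIntegral.integral_add (Continuous.intervalIntegrable (by fun_prop) _ _)
    (Continuous.intervalIntegrable (by fun_prop) _ _), hhM,
    intervalIntegral.integral_add (Continuous.intervalIntegrable (by fun_prop) _ _)
    (Continuous.intervalIntegrable (by fun_prop) _ _)]
  simp only [intervalIntegral.integral_const, intervalIntegral.integral_const_mul,
    integral_J_dither hfreq i₀ hH, integral_h_dither hfreq i₀, sub_zero, gradField, Prod.smul_mk,
    smul_add, smul_smul, inv_mul_cancel₀ hp, one_smul, smul_eq_mul, Prod.mk.injEq]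
  refine ⟨by rw [inv_mul_cancel_left₀ hp], ?_, ?_, ?_, ?_, ?_⟩
  · rw [← mul_assoc, inv_mul_cancel₀ hp, smul_sub, one_mul]; abel
  · field_simp; ring
  · rw [← mul_assoc, inv_mul_cancel₀ hp, smul_sub, one_mul]; abel
  · field_simp; ring
  · field_simp

end Data

/-! ### The smoothed maximum -/

section SmoothMax

variable {δ : ℝ}

lemma abs_lt_sqrt_sq_add (hδ : 0 < δ) (z : ℝ) : |z| < √(z ^ 2 + δ) := by
  rw [← Real.sqrt_sq_eq_abs]
  exact Real.sqrt_lt_sqrt (sq_nonneg z) (by linarith)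

lemma smoothMax_pos (hδ : 0 < δ) (z : ℝ) : 0 < smoothMax δ z := by
  have := abs_lt_sqrt_sq_add hδ z
  have := neg_abs_le z
  unfold smoothMax
  linarith

lemma smoothMax_mul_sub (hδ : 0 < δ) (z : ℝ) : smoothMax δ z * (smoothMax δ z - z) = δ / 4 := by
  have := Real.sq_sqrt (by positivity : 0 ≤ z ^ 2 + δ)
  unfold smoothMax
  linear_combination this / 4

lemma smoothMax_eq {y z : ℝ} (hδ : 0 < δ) (hy : 0 < y) (h : y * (y - z) = δ / 4) :
    smoothMax δ z = y := by
  have hyz : 0 < y - z := pos_of_mul_pos_right (by rw [h]; positivity) hy.le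
  have : √(z ^ 2 + δ) = 2 * y - z := by
    rw [Real.sqrt_eq_iff_mul_self_eq (by positivity) (by linarith)]
    linear_combination (-4) * h
  rw [smoothMax, this]
  ring

lemma contDiff_smoothMax (hδ : 0 < δ) : ContDiff ℝ 1 (smoothMax δ) := by
  unfold smoothMax
  have h : ContDiff ℝ 1 fun x : ℝ => x ^ 2 + δ := by fun_prop
  exact (contDiff_id.add (h.sqrt fun x => by positivity)).div_const 2

lemma exists_hasDerivAt_smoothMax (hδ : 0 < δ) (z : ℝ) :
    ∃ σ : ℝ, 0 < σ ∧ σ < 1 ∧ HasDerivAt (smoothMax δ) σ z := by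
  have h := abs_lt_sqrt_sq_add hδ z
  have hs : 0 < √(z ^ 2 + δ) := (abs_nonneg z).trans_lt h
  have hd : HasDerivAt (smoothMax δ) ((1 + 2 * z / (2 * √(z ^ 2 + δ))) / 2) z := by
    have h1 : HasDerivAt (fun x : ℝ => x ^ 2 + δ) (2 * z) z := by
      simpa using (hasDerivAt_pow 2 z).add_const δ
    exact ((hasDerivAt_id z).add (h1.sqrt (by positivity))).div_const 2
  have hq : |z / √(z ^ 2 + δ)| < 1 := by
    rw [abs_div, abs_of_pos hs, div_lt_one hs]
    exact h
  rw [mul_div_mul_left _ _ two_ne_zero] at hd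
  obtain ⟨h1, h2⟩ := abs_lt.1 hq
  exact ⟨_, by linarith, by linarith, hd⟩

end SmoothMax

/-! ### The multiplier equation -/

section Multiplier

variable {h₀ D ε : ℝ}

lemma exists_pos_root (hD : 0 < D) (hε : 0 < ε) (h₀ : ℝ) : ∃ μ, 0 < μ ∧ μ * (h₀ + μ * D) = ε := by
  have hs : 0 ≤ h₀ ^ 2 + 4 * D * ε := by positivity
  have hlt : |h₀| < √(h₀ ^ 2 + 4 * D * ε) := abs_lt_sqrt_sq_add (by positivity) h₀
  refine ⟨(-h₀ + √(h₀ ^ 2 + 4 * D * ε)) / (2 * D), ?_, ?_⟩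
  · have := le_abs_self h₀
    apply div_pos <;> linarith
  · have := Real.sq_sqrt hs
    field_simp
    linear_combination this

lemma pos_root_unique (hD : 0 < D) (hε : 0 < ε) {μ₁ μ₂ : ℝ} (h₁ : 0 < μ₁)
    (e₁ : μ₁ * (h₀ + μ₁ * D) = ε) (h₂ : 0 < μ₂) (e₂ : μ₂ * (h₀ + μ₂ * D) = ε) : μ₁ = μ₂ := by
  have hp : 0 < h₀ + μ₁ * D := pos_of_mul_pos_right (by rw [e₁]; exact hε) h₁.le
  have h : (μ₁ - μ₂) * (h₀ + μ₁ * D + μ₂ * D) = 0 := by linear_combination e₁ - e₂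
  have hne : h₀ + μ₁ * D + μ₂ * D ≠ 0 := (add_pos hp (mul_pos h₂ hD)).ne'
  linarith [(mul_eq_zero.1 h).resolve_right hne]

/-- The root differs from the multiplier `max 0 (-h₀ / D)` of the constrained problem by `O(ε)` in
the square; when `h₀ = 0` the difference of the roots themselves is only `O(√ε)`. -/
lemma abs_sq_sub_sq_le (hD : 0 < D) (hε : 0 < ε) {μ : ℝ} (hμ : 0 < μ)
    (e : μ * (h₀ + μ * D) = ε) : |μ ^ 2 - (max 0 (-h₀ / D)) ^ 2| ≤ 2 * ε / D := by
  have hp : 0 < h₀ + μ * D := pos_of_mul_pos_right (by rw [e]; exact hε) hμ.le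
  rw [le_div_iff₀ hD, ← abs_of_pos hD, ← abs_mul, abs_of_pos hD]
  rcases le_total 0 h₀ with h | h
  · rw [max_eq_left (div_nonpos_of_nonpos_of_nonneg (by linarith) hD.le),
      zero_pow two_ne_zero, sub_zero, abs_of_nonneg (by positivity)]
    nlinarith
  · have hm : 0 ≤ -h₀ / D := div_nonneg (by linarith) hD.le
    rw [max_eq_right hm]
    set ν := -h₀ / D with hν
    have h0 : h₀ = -(ν * D) := by rw [hν]; field_simp
    have hlt : ν < μ := by
      rw [hν, div_lt_iff₀ hD]; linarith
    have h1 : (μ ^ 2 - ν ^ 2) * D = ε + ν * D * (μ - ν) := by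
      rw [← e, h0]; ring
    have h2 : ν * D * (μ - ν) ≤ ε := by
      rw [← e, h0]
      have : 0 ≤ (μ - ν) * (μ - ν) * D := by positivity
      linarith
    rw [h1, abs_of_nonneg]
    · linarith
    · have : 0 ≤ ν * D * (μ - ν) := mul_nonneg (by positivity) (by linarith)
      linarith

end Multiplier

namespace Data

variable {n : ℕ} {P : Data n}

/-! ### The safe optimum and the equilibrium of the average system -/

lemma exists_hess_eq (hH : P.H.PosDef) (y : Vec n) : ∃ w, P.hess w = y := by
  have hinj : Function.Injective (P.hess : Vec n →ₗ[ℝ] Vec n) := by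
    rw [← LinearMap.ker_eq_bot, LinearMap.ker_eq_bot']
    intro x hx
    by_contra hne
    have h := inner_hess_pos hH x hne
    have hx' : P.hess x = 0 := hx
    simp [hx'] at h
  exact LinearMap.surjective_of_injective hinj y

/-- The safe minimum is attained at `θ^* + μ H⁻¹ h₁` with the multiplier `μ = max 0 (-h₀ / D)`,
`D = h₁ᵀ H⁻¹ h₁`. -/
lemma isLeast_J_safeSet (hH : P.H.PosDef) {w : Vec n} (hw : P.hess w = P.h₁) {D : ℝ}
    (hD : 0 < D) (hwD : ⟪P.h₁, w⟫_ℝ = D) :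
    IsLeast (P.J '' P.safeSet) (P.Jmin + 1 / 2 * ((max 0 (-P.h₀ / D)) ^ 2 * D)) := by
  set μ := max 0 (-P.h₀ / D) with hμ
  have hμ0 : 0 ≤ μ := le_max_left _ _
  have hfeas : 0 ≤ P.h₀ + μ * D := by
    have := le_max_right 0 (-P.h₀ / D)
    rw [← hμ, div_le_iff₀ hD] at this
    linarith
  have hcompl : μ * (P.h₀ + μ * D) = 0 := by
    rcases le_total (-P.h₀ / D) 0 with h | h
    · rw [hμ, max_eq_left h, zero_mul]
    · rw [hμ, max_eq_right h]; field_simp; ring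
  constructor
  · refine ⟨μ • w + P.θmin, ?_, ?_⟩
    · have := h_add (P := P) (μ • w) 0
      rw [add_zero, inner_zero_right, inner_smul_right, hwD] at this
      rw [safeSet, mem_ofPred_eq, this]
      linarith
    · rw [J_eq, add_sub_cancel_right, map_smul, hw, inner_smul_left, inner_smul_right, hwD]
      simp
      ring
  · rintro _ ⟨θ, hθ, rfl⟩
    set x := θ - P.θmin with hx
    have hθ' : 0 ≤ P.h₀ + ⟪P.h₁, x⟫_ℝ := hθ
    have hnn : 0 ≤ ⟪P.hess (x - μ • w), x - μ • w⟫_ℝ := by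
      rcases eq_or_ne (x - μ • w) 0 with h | h
      · rw [h]; simp
      · exact (inner_hess_pos hH _ h).le
    have hexp : ⟪P.hess (x - μ • w), x - μ • w⟫_ℝ
        = ⟪P.hess x, x⟫_ℝ - 2 * (μ * ⟪P.h₁, x⟫_ℝ) + μ ^ 2 * D := by
      have h1 : ⟪P.hess x, w⟫_ℝ = ⟪P.h₁, x⟫_ℝ := by
        rw [inner_hess_comm hH, hw, real_inner_comm]
      simp only [map_sub, map_smul, hw, inner_sub_left, inner_sub_right, inner_smul_left,
        inner_smul_right, RCLike.conj_to_real, h1, hwD]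
      ring
    rw [J_eq, ← hx]
    have := mul_le_mul_of_nonneg_left hθ' hμ0
    rw [hexp] at hnn
    linarith

variable (P) in
/-- The candidate equilibrium with the multiplier `μ`, where `w` stands for `H⁻¹ h₁`. -/
def eqPoint (w : Vec n) (e μ : ℝ) : State n :=
  (μ • w, μ • P.h₁, P.Jmin + 1 / 2 * ⟪P.hess (μ • w), μ • w⟫_ℝ + e, P.h₁, P.h₀ + ⟪P.h₁, μ • w⟫_ℝ,
    (‖P.h₁‖ ^ 2)⁻¹)

lemma smoothMax_eqPoint (hh₁ : P.h₁ ≠ 0) (hk : 0 < P.k) (hc : 0 < P.c) {δ D μ : ℝ} (hδ : 0 < δ)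
    (hμ : 0 < μ) (e : μ * (P.h₀ + μ * D) = δ / (4 * P.k * P.c * ‖P.h₁‖ ^ 2)) :
    smoothMax δ (P.k * (μ * ‖P.h₁‖ ^ 2) - P.c * (P.h₀ + μ * D)) = P.k * μ * ‖P.h₁‖ ^ 2 := by
  have hN : 0 < ‖P.h₁‖ ^ 2 := by positivity
  apply smoothMax_eq hδ (by positivity)
  rw [eq_div_iff (by positivity)] at e
  linear_combination e / 4

lemma gradField_eqPoint (hh₁ : P.h₁ ≠ 0) (hk : 0 < P.k) (hc : 0 < P.c)
    {w : Vec n} (hw : P.hess w = P.h₁) {D : ℝ} (hwD : ⟪P.h₁, w⟫_ℝ = D) {δ μ : ℝ} (hδ : 0 < δ)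
    (hμ : 0 < μ) (e : μ * (P.h₀ + μ * D) = δ / (4 * P.k * P.c * ‖P.h₁‖ ^ 2)) (q : ℝ) :
    P.gradField q δ (P.eqPoint w q μ) = 0 := by
  have hN : ‖P.h₁‖ ^ 2 ≠ 0 := by positivity
  have hs := smoothMax_eqPoint hh₁ hk hc hδ hμ e
  simp only [gradField, eqPoint, inner_smul_left, inner_smul_right, hwD, RCLike.conj_to_real,
    real_inner_self_eq_norm_sq, hs, map_smul, hw, sub_self, smul_zero, mul_zero,
    inv_mul_cancel₀ hN]
  simp only [Prod.mk_eq_zero, and_true]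
  rw [smul_smul, ← neg_smul, ← add_smul]
  have : -(P.k * μ) + (‖P.h₁‖ ^ 2)⁻¹ * (P.k * μ * ‖P.h₁‖ ^ 2) = 0 := by field_simp; ring
  rw [this, zero_smul]

lemma exists_eq_eqPoint (hH : P.H.PosDef) (hh₁ : P.h₁ ≠ 0) (hk : 0 < P.k) (hc : 0 < P.c)
    (hωf : 0 < P.ωf) {w : Vec n} (hw : P.hess w = P.h₁) {D : ℝ} (hwD : ⟪P.h₁, w⟫_ℝ = D)
    {δ q : ℝ} (hδ : 0 < δ) {x : State n} (hx : P.gradField q δ x = 0) (hγ : 0 < x.2.2.2.2.2) :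
    ∃ μ, 0 < μ ∧ μ * (P.h₀ + μ * D) = δ / (4 * P.k * P.c * ‖P.h₁‖ ^ 2) ∧ x = P.eqPoint w q μ := by
  obtain ⟨θ, GJ, ηJ, Gh, ηh, γ⟩ := x
  have hN : 0 < ‖P.h₁‖ ^ 2 := by positivity
  have hω := hωf.ne'
  simp only [gradField, Prod.mk_eq_zero, smul_eq_zero, mul_eq_zero, hω, false_or] at hx
  obtain ⟨h1, h2, h3, h4, h5, h6⟩ := hx
  have hγ0 : 0 < γ := hγ
  have e4 : Gh = P.h₁ := (sub_eq_zero.1 h4).symm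
  subst e4
  have e2 : GJ = P.hess θ := (sub_eq_zero.1 h2).symm
  subst e2
  have e6 : γ = (‖P.h₁‖ ^ 2)⁻¹ := by
    have := h6.resolve_left hγ0.ne'
    rw [eq_comm, inv_eq_iff_eq_inv, eq_comm, inv_eq_of_mul_eq_one_right]
    linarith
  have e5 : ηh = P.h₀ + ⟪P.h₁, θ⟫_ℝ := by linarith
  have e3 : ηJ = P.Jmin + 1 / 2 * ⟪P.hess θ, θ⟫_ℝ + q := by linarith
  set s := smoothMax δ (P.k * ⟪P.hess θ, P.h₁⟫_ℝ - P.c * ηh) with hs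
  have hs0 : 0 < s := smoothMax_pos hδ _
  set μ := P.k⁻¹ * (γ * s) with hμ
  have hμ0 : 0 < μ := by positivity
  have hHθ : P.hess θ = μ • P.h₁ := by
    have : P.k • P.hess θ = (γ * s) • P.h₁ := by
      rw [← sub_eq_zero, ← neg_eq_zero, ← h1]; abel
    rw [hμ, ← smul_smul, ← this, smul_smul, inv_mul_cancel₀ hk.ne', one_smul]
  have hθ : θ = μ • w := by
    by_contra hne
    have := inner_hess_pos hH (θ - μ • w) (sub_ne_zero.2 hne)
    rw [map_sub, map_smul, hw, hHθ, sub_self, inner_zero_left] at this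
    exact lt_irrefl _ this
  have hs' : s = P.k * μ * ‖P.h₁‖ ^ 2 := by
    rw [hμ, e6]; field_simp
  have hmul : s * (s - (P.k * ⟪P.hess θ, P.h₁⟫_ℝ - P.c * ηh)) = δ / 4 := smoothMax_mul_sub hδ _
  rw [e5, hHθ, hθ, inner_smul_left, inner_smul_right, hwD, real_inner_self_eq_norm_sq,
    RCLike.conj_to_real, hs'] at hmul
  refine ⟨μ, hμ0, ?_, ?_⟩
  · rw [eq_div_iff (by positivity)]
    linear_combination 4 * hmul
  · rw [eqPoint, ← hθ, e3, e5, ← hHθ, e6]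

end Data

namespace Data

variable {n : ℕ} {P : Data n}

/-! ### Stability of the linearized average system -/

lemma contDiff_rhs {δ : ℝ} (hδ : 0 < δ) :
    ContDiff ℝ 1 fun q : Vec n × Vec n × State n => P.rhs δ q.1 q.2.1 (P.ofError q.2.2) := by
  have hJ : ContDiff ℝ 1 P.J := by
    have : P.J = fun θ => P.Jmin + 1 / 2 * ⟪P.hess (θ - P.θmin), θ - P.θmin⟫_ℝ := funext J_eq
    rw [this]
    exact contDiff_const.add (contDiff_const.mul
      ((P.hess.contDiff.comp (by fun_prop)).inner ℝ (by fun_prop)))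
  have hh : ContDiff ℝ 1 P.h := by
    unfold h
    exact contDiff_const.add (contDiff_const.inner ℝ (by fun_prop))
  have hs := contDiff_smoothMax hδ
  have hJ' : ContDiff ℝ 1 fun q : Vec n × Vec n × State n => P.J (q.2.2.1 + P.θmin + q.1) :=
    hJ.comp (by fun_prop)
  have hh' : ContDiff ℝ 1 fun q : Vec n × Vec n × State n => P.h (q.2.2.1 + P.θmin + q.1) :=
    hh.comp (by fun_prop)
  have hs' : ContDiff ℝ 1 fun q : Vec n × Vec n × State n =>
      smoothMax δ (P.k * ⟪q.2.2.2.1, q.2.2.2.2.2.1⟫_ℝ - P.c * q.2.2.2.2.2.2.1) :=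
    hs.comp ((contDiff_const.mul (ContDiff.inner ℝ (by fun_prop) (by fun_prop))).sub (by fun_prop))
  have hn : ContDiff ℝ 1 fun q : Vec n × Vec n × State n => ‖q.2.2.2.2.2.1‖ ^ 2 :=
    ContDiff.norm_sq ℝ (by fun_prop)
  simp only [rhs, ofError]
  fun_prop

lemma differentiable_gradField {δ : ℝ} (hδ : 0 < δ) (e : ℝ) :
    Differentiable ℝ (P.gradField e δ) := by
  have hs : Differentiable ℝ (smoothMax δ) := (contDiff_smoothMax hδ).differentiable one_ne_zero
  have hs' : Differentiable ℝ fun x : State n =>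
      smoothMax δ (P.k * ⟪x.2.1, x.2.2.2.1⟫_ℝ - P.c * x.2.2.2.2.1) :=
    hs.comp (((Differentiable.inner ℝ (by fun_prop) (by fun_prop)).const_mul _).sub (by fun_prop))
  have hn : Differentiable ℝ fun x : State n => ‖x.2.2.2.1‖ ^ 2 :=
    Differentiable.norm_sq ℝ (by fun_prop)
  have hq : Differentiable ℝ fun x : State n => P.hess x.1 :=
    P.hess.differentiable.comp (by fun_prop)
  have hq' : Differentiable ℝ fun x : State n => ⟪P.hess x.1, x.1⟫_ℝ := hq.inner ℝ (by fun_prop)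
  have hl : Differentiable ℝ fun x : State n => ⟪P.h₁, x.1⟫_ℝ :=
    Differentiable.inner ℝ (by fun_prop) (by fun_prop)
  unfold gradField
  fun_prop

/-- The derivative of the average field, computed along lines. -/
lemma fderiv_gradField_apply (hH : P.H.PosDef) {δ : ℝ} (hδ : 0 < δ) (e : ℝ)
    (θ₀ G₀ : Vec n) (j₀ : ℝ) (g₀ : Vec n) (η₀ γ₀ : ℝ) {σ : ℝ}
    (hσ : HasDerivAt (smoothMax δ) σ (P.k * ⟪G₀, g₀⟫_ℝ - P.c * η₀))
    (θ G : Vec n) (j : ℝ) (g : Vec n) (η γ : ℝ) :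
    fderiv ℝ (P.gradField e δ) (θ₀, G₀, j₀, g₀, η₀, γ₀) (θ, G, j, g, η, γ) =
      (-(P.k • G) + ((γ₀ * smoothMax δ (P.k * ⟪G₀, g₀⟫_ℝ - P.c * η₀)) • g +
          (γ * smoothMax δ (P.k * ⟪G₀, g₀⟫_ℝ - P.c * η₀)
            + γ₀ * (σ * (P.k * (⟪G₀, g⟫_ℝ + ⟪G, g₀⟫_ℝ) - P.c * η))) • g₀),
        P.ωf • (P.hess θ - G),
        P.ωf * (⟪P.hess θ₀, θ⟫_ℝ - j),
        P.ωf • (-g),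
        P.ωf * (⟪P.h₁, θ⟫_ℝ - η),
        P.ωf * γ * (1 - γ₀ * ‖g₀‖ ^ 2) - P.ωf * γ₀ * (γ * ‖g₀‖ ^ 2 + γ₀ * (2 * ⟪g₀, g⟫_ℝ))) := by
  have hf := (differentiable_gradField (P := P) hδ e (θ₀, G₀, j₀, g₀, η₀, γ₀)).hasFDerivAt
  have hline : ∀ {V : Type} [NormedAddCommGroup V] [NormedSpace ℝ V] (u v : V),
      HasDerivAt (fun s : ℝ => u + s • v) v 0 := fun u v => by
    simpa using ((hasDerivAt_id (0 : ℝ)).smul_const v).const_add u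
  have hlineR : ∀ u v : ℝ, HasDerivAt (fun s : ℝ => u + s * v) v 0 := fun u v => hline u v
  have hcomp := HasFDerivAt.comp_hasDerivAt (x := (0 : ℝ))
    (f := fun s : ℝ => ((θ₀, G₀, j₀, g₀, η₀, γ₀) + s • (θ, G, j, g, η, γ) : State n))
    (f' := (θ, G, j, g, η, γ)) (l := P.gradField e δ)
    (by simpa using hf) (hline _ _)
  refine hcomp.unique ?_
  have hz : HasDerivAt (fun s : ℝ => P.k * ⟪G₀ + s • G, g₀ + s • g⟫_ℝ - P.c * (η₀ + s * η))
      (P.k * (⟪G₀, g⟫_ℝ + ⟪G, g₀⟫_ℝ) - P.c * η) 0 := by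
    exact ((((hline G₀ G).inner ℝ (hline g₀ g)).const_mul P.k).sub
      ((hlineR η₀ η).const_mul P.c)).congr_deriv (by simp)
  have hsm : HasDerivAt (fun s : ℝ =>
      smoothMax δ (P.k * ⟪G₀ + s • G, g₀ + s • g⟫_ℝ - P.c * (η₀ + s * η)))
      (σ * (P.k * (⟪G₀, g⟫_ℝ + ⟪G, g₀⟫_ℝ) - P.c * η)) 0 :=
    HasDerivAt.comp (h₂ := smoothMax δ) 0 (by simpa using hσ) hz
  have hns : HasDerivAt (fun s : ℝ => ‖g₀ + s • g‖ ^ 2) (2 * ⟪g₀, g⟫_ℝ) 0 := by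
    simpa using (hline g₀ g).norm_sq
  have hHl : HasDerivAt (fun s : ℝ => P.hess (θ₀ + s • θ)) (P.hess θ) 0 :=
    P.hess.hasFDerivAt.comp_hasDerivAt 0 (hline θ₀ θ)
  refine HasDerivAt.prodMk ?_ (HasDerivAt.prodMk ?_ (HasDerivAt.prodMk ?_ (HasDerivAt.prodMk ?_
    (HasDerivAt.prodMk ?_ ?_))))
  · exact ((((hline G₀ G).const_smul P.k).neg).add
      (((hlineR γ₀ γ).mul hsm).smul (hline g₀ g))).congr_deriv (by simp)
  · exact (hHl.sub (hline G₀ G)).const_smul P.ωf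
  · have h1 := (((((hHl.inner ℝ (hline θ₀ θ)).const_mul (1 / 2)).const_add P.Jmin).add_const
      e).sub (hlineR j₀ j)).const_mul P.ωf
    refine h1.congr_deriv ?_
    simp only [zero_smul, add_zero]
    rw [inner_hess_comm hH θ θ₀, real_inner_comm _ θ]
    ring
  · exact ((hline g₀ g).const_sub P.h₁).const_smul P.ωf
  · have h1 := ((((hasDerivAt_const (0 : ℝ) P.h₁).inner ℝ (hline θ₀ θ)).const_add P.h₀).sub
      (hlineR η₀ η)).const_mul P.ωf
    refine h1.congr_deriv ?_
    simp
  · have h1 := ((hlineR γ₀ γ).const_mul P.ωf).mul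
      (((hlineR γ₀ γ).mul hns).const_sub 1)
    refine h1.congr_deriv ?_
    simp
    ring

/-- In the coordinates `G`, `η_J`, `η_h`, `(θ, v)` with `v = -θ'` at frozen `γ`, `G_h`, and
`γ`, `G_h`, the linearized system is a cascade: each block is driven by the blocks to its right.
The block `(θ, v)` is a second order system, all the others decay at the rate `ω_f`. -/
lemma hasQuadraticLyapunov_fderiv_gradField (hH : P.H.PosDef) (hk : 0 < P.k) (hc : 0 < P.c)
    (hωf : 0 < P.ωf) {δ : ℝ} (hδ : 0 < δ) (e : ℝ) (θ₀ G₀ : Vec n) (j₀ η₀ : ℝ) (hh₁ : P.h₁ ≠ 0) :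
    HasQuadraticLyapunov
      (fderiv ℝ (P.gradField e δ) (θ₀, G₀, j₀, P.h₁, η₀, (‖P.h₁‖ ^ 2)⁻¹)) := by
  obtain ⟨σ, hσ0, hσ1, hσ⟩ :=
    exists_hasDerivAt_smoothMax hδ (P.k * ⟪G₀, P.h₁⟫_ℝ - P.c * η₀)
  have hN : 0 < ‖P.h₁‖ ^ 2 := by positivity
  set N := ‖P.h₁‖ ^ 2 with hNdef
  set s := smoothMax δ (P.k * ⟪G₀, P.h₁⟫_ℝ - P.c * η₀) with hs
  have hσ' : 0 < 1 - σ := by linarith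
  -- the rank-one map `x ↦ ⟪h₁, x⟫ h₁`
  set U : Vec n →L[ℝ] Vec n := (innerSL ℝ P.h₁).smulRight P.h₁ with hU
  have hUa : ∀ x, U x = ⟪P.h₁, x⟫_ℝ • P.h₁ := fun x => rfl
  set ψ : Vec n →L[ℝ] ℝ := innerSL ℝ P.h₁ with hψ
  have hψa : ∀ x, ψ x = ⟪P.h₁, x⟫_ℝ := fun x => rfl
  set M : Vec n →L[ℝ] Vec n :=
    P.k • P.hess - (N⁻¹ * σ) • (P.k • U.comp P.hess - P.c • U) with hM
  set R : Vec n →L[ℝ] Vec n := .id ℝ (Vec n) + (N⁻¹ * (σ / (1 - σ))) • U with hR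
  set Q : Vec n →L[ℝ] Vec n := P.k • P.hess + (P.c * N⁻¹ * (σ / (1 - σ))) • U with hQ
  have hRM : ∀ x, R (M x) = Q x := fun x => by
    have hself : ⟪P.h₁, P.h₁⟫_ℝ = N := real_inner_self_eq_norm_sq _
    simp only [hR, hM, hQ, add_apply, sub_apply, smul_apply, ContinuousLinearMap.comp_apply,
      ContinuousLinearMap.id_apply, hUa, inner_sub_right, inner_smul_right, hself]
    match_scalars <;> field_simp
    ring
  have hUs : ∀ x y, ⟪U x, y⟫_ℝ = ⟪x, U y⟫_ℝ := fun x y => by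
    simp only [hUa, inner_smul_left, inner_smul_right, RCLike.conj_to_real]
    rw [real_inner_comm P.h₁ x]; ring
  have hUn : ∀ x, 0 ≤ ⟪U x, x⟫_ℝ := fun x => by
    simp only [hUa, inner_smul_left, RCLike.conj_to_real]
    exact mul_self_nonneg _
  have hcore := hasQuadraticLyapunov_secondOrder hωf hRM
    (fun x y => by
      simp only [hR, add_apply, smul_apply, ContinuousLinearMap.id_apply, inner_add_left,
        inner_add_right, inner_smul_left, inner_smul_right, RCLike.conj_to_real, hUs x y])
    (fun x hx => by
      have h1 : 0 < ⟪x, x⟫_ℝ := real_inner_self_pos.2 hx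
      have h2 := hUn x
      simp only [hR, add_apply, smul_apply, ContinuousLinearMap.id_apply, inner_add_left,
        inner_smul_left, RCLike.conj_to_real]
      positivity)
    (fun x y => by
      simp only [hQ, add_apply, smul_apply, inner_add_left, inner_add_right, inner_smul_left,
        inner_smul_right, RCLike.conj_to_real, hUs x y, inner_hess_comm hH x y])
    (fun x hx => by
      have h1 := inner_hess_pos hH x hx
      have h2 := hUn x
      simp only [hQ, add_apply, smul_apply, inner_add_left, inner_smul_left, RCLike.conj_to_real]
      positivity)
  have hdecay := hasQuadraticLyapunov_neg_smul_id (E := Vec n) hωf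
  have hdecayR := hasQuadraticLyapunov_neg_smul_id (E := ℝ) hωf
  have hγg := hdecayR.cascade hdecay (-(2 * P.ωf * N⁻¹ ^ 2) • ψ)
  -- the forcing of `θ'` by `γ` and `G_h`
  set C : ℝ × Vec n →L[ℝ] Vec n :=
    (ContinuousLinearMap.fst ℝ ℝ (Vec n)).smulRight (s • P.h₁)
      + (N⁻¹ * σ * P.k) • ((innerSL ℝ G₀).smulRight P.h₁).comp (.snd ℝ ℝ (Vec n))
      + (N⁻¹ * s) • .snd ℝ ℝ (Vec n) with hC
  have h4 := hcore.cascade hγg (C.prod 0)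
  have h3 := hdecayR.cascade h4
    (P.ωf • ψ.comp ((ContinuousLinearMap.fst ℝ (Vec n) (Vec n)).comp (.fst ℝ _ _)))
  have h2 := hdecayR.cascade h3 (P.ωf • (innerSL ℝ (P.hess θ₀)).comp
    ((ContinuousLinearMap.fst ℝ (Vec n) (Vec n)).comp
      ((ContinuousLinearMap.fst ℝ _ _).comp (.snd ℝ ℝ _))))
  have h1 := hdecay.cascade h2 (P.ωf • P.hess.comp
    ((ContinuousLinearMap.fst ℝ (Vec n) (Vec n)).comp
      ((ContinuousLinearMap.fst ℝ _ _).comp ((ContinuousLinearMap.snd ℝ ℝ _).comp (.snd ℝ ℝ _)))))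
  set L : State n →ₗ[ℝ] Vec n × ℝ × ℝ × (Vec n × Vec n) × ℝ × Vec n :=
    { toFun := fun x => (x.2.1, x.2.2.1, x.2.2.2.2.1,
        (x.1, P.k • x.2.1 - (N⁻¹ * (σ * (P.k * ⟪P.h₁, x.2.1⟫_ℝ - P.c * x.2.2.2.2.1))) • P.h₁),
        x.2.2.2.2.2, x.2.2.2.1)
      map_add' := fun x y => by
        simp only [Prod.fst_add, Prod.snd_add, Prod.mk_add_mk, inner_add_right, Prod.mk.injEq,
          true_and, and_true]
        module
      map_smul' := fun r x => by
        simp only [Prod.smul_fst, Prod.smul_snd, Prod.smul_mk, inner_smul_right, Prod.mk.injEq,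
          true_and, and_true, RingHom.id_apply, smul_eq_mul]
        module } with hL
  refine h1.of_semiconj (LinearMap.toContinuousLinearMap L) ?_ ?_
  · rintro ⟨θ, G, j, g, η, γ⟩ h
    simp [hL] at h
    simp [h]
  · rintro ⟨θ, G, j, g, η, γ⟩
    rw [fderiv_gradField_apply hH hδ e θ₀ G₀ j₀ P.h₁ η₀ N⁻¹ hσ]
    simp only [hL, hC, hM, hUa, hψa, LinearMap.coe_toContinuousLinearMap', LinearMap.coe_mk,
      AddHom.coe_mk, ContinuousLinearMap.prod_apply, add_apply, neg_apply, smul_apply, sub_apply,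
      ContinuousLinearMap.comp_apply, ContinuousLinearMap.coe_fst', ContinuousLinearMap.coe_snd',
      ContinuousLinearMap.id_apply, ContinuousLinearMap.smulRight_apply, innerSL_apply_apply,
      Prod.mk.injEq, Prod.mk_add_mk, smul_eq_mul,
      zero_apply, ← hs, ← hNdef]
    refine ⟨?_, ?_, ?_, ⟨?_, ?_⟩, ?_, ?_⟩
    · module
    · ring
    · ring
    · rw [real_inner_comm P.h₁ G]
      match_scalars <;> ring
    · simp only [inner_smul_right, inner_sub_right]
      match_scalars <;> ring
    · have : N⁻¹ * N = 1 := inv_mul_cancel₀ hN.ne'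
      linear_combination (-2 * P.ωf * γ) * this
    · module

end Data

/-! ### Error coordinates and the bound on the objective -/

lemma norm_le_stateNorm {n : ℕ} (x : State n) : ‖x‖ ≤ stateNorm x := by
  obtain ⟨θ, GJ, ηJ, Gh, ηh, γ⟩ := x
  have h1 := sq_nonneg ‖θ‖
  have h2 := sq_nonneg ‖GJ‖
  have h3 := sq_nonneg ηJ
  have h4 := sq_nonneg ‖Gh‖
  have h5 := sq_nonneg ηh
  have h6 := sq_nonneg γ
  have key : ∀ b : ℝ, b ^ 2 ≤ ‖θ‖ ^ 2 + ‖GJ‖ ^ 2 + ηJ ^ 2 + ‖Gh‖ ^ 2 + ηh ^ 2 + γ ^ 2 →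
      b ≤ stateNorm ((θ, GJ, ηJ, Gh, ηh, γ) : State n) := fun b hb => Real.le_sqrt_of_sq_le hb
  simp only [Prod.norm_def, sup_le_iff]
  refine ⟨key _ ?_, key _ ?_, key _ ?_, key _ ?_, key _ ?_, key _ ?_⟩ <;>
    (try rw [Real.norm_eq_abs, sq_abs]) <;> linarith

lemma isBoundedUnder_abs_and_abs_limsup_sub_le {f : ℝ → ℝ} {l κ : ℝ}
    (h : ∀ᶠ t in atTop, |f t - l| ≤ κ) :
    IsBoundedUnder (· ≤ ·) atTop (fun t => |f t|) ∧ |limsup f atTop - l| ≤ κ := by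
  have hu : ∀ᶠ t in atTop, f t ≤ l + κ := h.mono fun t ht => by linarith [(abs_le.1 ht).2]
  have hl : ∀ᶠ t in atTop, l - κ ≤ f t := h.mono fun t ht => by linarith [(abs_le.1 ht).1]
  have hbu : IsBoundedUnder (· ≤ ·) atTop f := ⟨_, eventually_map.2 hu⟩
  have hbl : IsBoundedUnder (· ≥ ·) atTop f := ⟨_, eventually_map.2 hl⟩
  refine ⟨⟨|l| + κ, eventually_map.2 (h.mono fun t ht => ?_)⟩, abs_le.2 ⟨?_, ?_⟩⟩
  · have := abs_sub_abs_le_abs_sub (f t) l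
    linarith
  · have := le_limsup_of_frequently_le hl.frequently hbu
    linarith
  · have := limsup_le_of_le hbl.isCoboundedUnder_le hu
    linarith

namespace Data

variable {n : ℕ} {P : Data n}

lemma dither_scaledFreq (a ω t : ℝ) : dither a (P.scaledFreq ω) t = dither a P.freq (ω * t) := by
  simp only [dither, scaledFreq, mul_right_comm ω, mul_comm (ω * t)]

lemma demod_scaledFreq (a ω t : ℝ) : demod a (P.scaledFreq ω) t = demod a P.freq (ω * t) := by
  simp only [demod, scaledFreq, mul_right_comm ω, mul_comm (ω * t)]

lemma ofError_eq (x : State n) : P.ofError x = x + (P.θmin, 0) := by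
  obtain ⟨θ, r⟩ := x
  simp [ofError]

lemma isSolution_iff {a δ ω : ℝ} {x : ℝ → State n} :
    P.IsSolution a δ ω (fun t => P.ofError (x t)) ↔
      IsIntegralCurveOn x (fun t => P.errorField a δ (ω * t)) (Ici 0) := by
  have h : (fun t => P.ofError (x t)) = fun t => x t + (P.θmin, 0) := funext fun t => ofError_eq _
  simp only [IsSolution, IsIntegralCurveOn, errorField, dither_scaledFreq, demod_scaledFreq]
  rw [h]
  simp only [hasDerivWithinAt_add_const_iff]

lemma continuous_errorField {δ : ℝ} (hδ : 0 < δ) (a : ℝ) :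
    Continuous (Function.uncurry (P.errorField a δ)) :=
  (contDiff_rhs hδ).continuous.comp (by fun_prop :
    Continuous fun q : ℝ × State n => (dither a P.freq q.1, demod a P.freq q.1, q.2))

lemma exists_lipschitzOnWith_errorField {a δ : ℝ} (ha : 0 ≤ a) (hδ : 0 < δ) (c : State n)
    (R : ℝ) :
    ∃ K : NNReal, ∀ τ, LipschitzOnWith K (P.errorField a δ τ) (Metric.closedBall c R) := by
  obtain ⟨K, hK⟩ := (contDiff_rhs (P := P) hδ).contDiffOn.exists_lipschitzOnWith one_ne_zero
    ((convex_closedBall (0 : Vec n) (√n * a)).prod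
      ((convex_closedBall (0 : Vec n) (√n * (2 / a))).prod (convex_closedBall c R)))
    ((isCompact_closedBall _ _).prod ((isCompact_closedBall _ _).prod (isCompact_closedBall _ _)))
  refine ⟨K, fun τ => LipschitzOnWith.of_dist_le_mul fun x hx y hy => ?_⟩
  have hs := mem_closedBall_zero_iff.2 (norm_dither_le ha P.freq τ)
  have hm := mem_closedBall_zero_iff.2 (norm_demod_le ha P.freq τ)
  have := hK.dist_le_mul (dither a P.freq τ, demod a P.freq τ, x) ⟨hs, hm, hx⟩
    (dither a P.freq τ, demod a P.freq τ, y) ⟨hs, hm, hy⟩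
  rwa [dist_prod_same_left, dist_prod_same_left] at this

/-- The objective near `θ^* + μ H⁻¹ h₁`. -/
lemma abs_J_sub_le {w : Vec n} (hH : P.H.PosDef) (hw : P.hess w = P.h₁) {D : ℝ}
    (hwD : ⟪P.h₁, w⟫_ℝ = D) {μ r : ℝ} (hμ : 0 ≤ μ) {u : Vec n} (hu : ‖u‖ ≤ r) :
    |P.J (μ • w + P.θmin + u) - (P.Jmin + 1 / 2 * (μ ^ 2 * D))|
      ≤ μ * ‖P.h₁‖ * r + 1 / 2 * ‖P.hess‖ * r ^ 2 := by
  have hr : 0 ≤ r := (norm_nonneg u).trans hu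
  have e : P.J (μ • w + P.θmin + u) - (P.Jmin + 1 / 2 * (μ ^ 2 * D))
      = μ * ⟪P.h₁, u⟫_ℝ + 1 / 2 * ⟪P.hess u, u⟫_ℝ := by
    rw [J_add hH, map_smul, hw, inner_smul_left, inner_smul_left, inner_smul_right, hwD,
      RCLike.conj_to_real]
    ring
  have h1 : |⟪P.h₁, u⟫_ℝ| ≤ ‖P.h₁‖ * r :=
    (abs_real_inner_le_norm _ _).trans (by gcongr)
  have h2 : |⟪P.hess u, u⟫_ℝ| ≤ ‖P.hess‖ * r ^ 2 :=
    calc |⟪P.hess u, u⟫_ℝ| ≤ ‖P.hess u‖ * ‖u‖ := abs_real_inner_le_norm _ _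
      _ ≤ (‖P.hess‖ * ‖u‖) * ‖u‖ := by gcongr; exact P.hess.le_opNorm u
      _ ≤ (‖P.hess‖ * r) * r := by gcongr
      _ = ‖P.hess‖ * r ^ 2 := by ring
  rw [e]
  calc |μ * ⟪P.h₁, u⟫_ℝ + 1 / 2 * ⟪P.hess u, u⟫_ℝ|
      ≤ |μ * ⟪P.h₁, u⟫_ℝ| + |1 / 2 * ⟪P.hess u, u⟫_ℝ| := abs_add_le _ _
    _ = μ * |⟪P.h₁, u⟫_ℝ| + 1 / 2 * |⟪P.hess u, u⟫_ℝ| := by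
        rw [abs_mul, abs_mul, abs_of_nonneg hμ, abs_of_pos (by norm_num : (0 : ℝ) < 1 / 2)]
    _ ≤ μ * (‖P.h₁‖ * r) + 1 / 2 * (‖P.hess‖ * r ^ 2) := by gcongr
    _ = μ * ‖P.h₁‖ * r + 1 / 2 * ‖P.hess‖ * r ^ 2 := by ring

end Data

end ASfES

end

theorem theorem1 {n : ℕ} (P : ASfES.Data n)
    (hH : P.H.PosDef) (hh₁ : P.h₁ ≠ 0)
    (hk : 0 < P.k) (hc : 0 < P.c) (hωf : 0 < P.ωf)
    (hfreq : ASfES.AdmissibleFreq P.freq) :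
    -- `Js` is the minimum of `J` on the safe set
    ∃ Js : ℝ, IsLeast (P.J '' P.safeSet) Js ∧
      -- the constant `C` of the `O` symbol is uniform in `ω` and in `a`, `δ` of bounded size
      ∀ A : ℝ, 0 < A → ∃ C : ℝ, 0 < C ∧
        ∀ a δ : ℝ, 0 < a → a ≤ A → 0 < δ → δ ≤ A →
          -- `xe` is the unique equilibrium of the average system with positive `γ`
          ∃ xe : ASfES.State n, P.IsAvgEquilibrium a δ xe ∧
            (∀ y : ASfES.State n, P.IsAvgEquilibrium a δ y → y = xe) ∧
            ∃ ρ ωs : ℝ, 0 < ρ ∧ 0 < ωs ∧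
              -- `x₀` is the initial state in the error coordinates
              ∀ x₀ : ASfES.State n, ASfES.stateNorm (x₀ - xe) < ρ →
                ∀ ω : ℝ, ωs ≤ ω →
                  (∃ x : ℝ → ASfES.State n, P.IsSolution a δ ω x ∧ x 0 = P.ofError x₀) ∧
                  ∀ x : ℝ → ASfES.State n, P.IsSolution a δ ω x → x 0 = P.ofError x₀ →
                    Filter.IsBoundedUnder (· ≤ ·) Filter.atTop
                      (fun t => |P.J (P.param a ω x t)|) ∧
                    |Filter.limsup (fun t => P.J (P.param a ω x t)) Filter.atTop - Js|
                      ≤ C * (1 / ω + a + δ) := by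
  open ASfES ASfES.Data in
  obtain ⟨i₀⟩ : Nonempty (Fin n) := by
    by_contra hne
    rw [not_nonempty_iff] at hne
    exact hh₁ (Subsingleton.elim _ _)
  obtain ⟨w, hw⟩ := exists_hess_eq hH P.h₁
  obtain ⟨D, hwD⟩ : ∃ D, ⟪P.h₁, w⟫_ℝ = D := ⟨_, rfl⟩
  have hD : 0 < D := by
    rw [← hwD, ← hw]
    refine inner_hess_pos hH w ?_
    rintro rfl
    exact hh₁ (by rw [← hw, map_zero])
  have hN : 0 < ‖P.h₁‖ ^ 2 := by positivity
  set μ₀ := max 0 (-P.h₀ / D) with hμ₀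
  refine ⟨_, isLeast_J_safeSet hH hw hD hwD, fun A hA => ?_⟩
  -- the right-hand side of the equation for `μ` is `κ δ`; `b` bounds `μ ^ 2` for all `δ ≤ A`
  set κ : ℝ := (4 * P.k * P.c * ‖P.h₁‖ ^ 2)⁻¹ with hκ
  have hκ0 : 0 < κ := by positivity
  set b : ℝ := μ₀ ^ 2 + 2 * (A * κ) / D with hb
  have hb0 : 0 ≤ b := by positivity
  set r : ℝ := 1 + √n with hr
  have hr0 : 0 < r := by positivity
  set C₁ : ℝ := (1 + b) * ‖P.h₁‖ * r + 1 / 2 * ‖P.hess‖ * r ^ 2 * A with hC₁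
  have hC₁0 : 0 ≤ C₁ := by positivity
  refine ⟨C₁ + κ, by positivity, fun a δ ha haA hδ hδA => ?_⟩
  have hε : 0 < δ / (4 * P.k * P.c * ‖P.h₁‖ ^ 2) := by positivity
  have hεκ : δ / (4 * P.k * P.c * ‖P.h₁‖ ^ 2) = δ * κ := div_eq_mul_inv _ _
  obtain ⟨μ, hμ, hμe⟩ := exists_pos_root hD hε P.h₀
  have hclose := abs_sq_sub_sq_le hD hε hμ hμe
  rw [← hμ₀, hεκ] at hclose
  have hμb : μ ≤ 1 + b := by
    have h1 : μ ^ 2 - μ₀ ^ 2 ≤ 2 * (A * κ) / D :=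
      (le_abs_self _).trans (hclose.trans (by gcongr))
    nlinarith [sq_nonneg (μ - 1)]
  have havg := avgField_eq hfreq i₀ hH ha.ne' δ
  set xe := P.eqPoint w (P.ditherMean a) μ with hxe
  have hzero : P.avgField a δ xe = 0 := by
    rw [havg]
    exact gradField_eqPoint hh₁ hk hc hw hwD hδ hμ hμe _
  refine ⟨xe, ⟨hzero, inv_pos.2 hN⟩, ?_, ?_⟩
  · rintro y ⟨hy, hyγ⟩
    rw [havg] at hy
    obtain ⟨μ', hμ', hμe', rfl⟩ := exists_eq_eqPoint hH hh₁ hk hc hωf hw hwD hδ hy hyγ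
    rw [hxe, pos_root_unique hD hε hμ hμe hμ' hμe']
  have hfd : HasFDerivAt (P.avgField a δ) (fderiv ℝ (P.gradField (P.ditherMean a) δ) xe) xe := by
    rw [havg]
    exact (differentiable_gradField hδ _ xe).hasFDerivAt
  -- closeness `a` to the equilibrium suffices, as the dither itself contributes `O(a)`
  obtain ⟨ρ, ωs, hρ, hωs, hstab⟩ := exists_stability_of_average (hfreq.period_pos i₀)
    (continuous_errorField (P := P) hδ a)
    (fun y τ => by
      simp only [errorField, hfreq.dither_periodic i₀ a τ, hfreq.demod_periodic i₀ a τ])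
    (exists_lipschitzOnWith_errorField ha.le hδ xe) hzero hfd
    (hasQuadraticLyapunov_fderiv_gradField hH hk hc hωf hδ _ _ _ _ _ hh₁) ha
  refine ⟨ρ, ωs, hρ, hωs, fun x₀ hx₀ ω hω => ?_⟩
  have hω0 : 0 < ω := hωs.trans_le hω
  obtain ⟨hex, hall⟩ := hstab x₀ ((norm_le_stateNorm _).trans_lt hx₀) ω hω
  refine ⟨?_, fun x hx hx0 => ?_⟩
  · obtain ⟨x, hx, hx0⟩ := hex
    exact ⟨fun t => P.ofError (x t), isSolution_iff.2 hx, congrArg P.ofError hx0⟩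
  · set y : ℝ → State n := fun t => x t - (P.θmin, 0) with hy
    have hxy : x = fun t => P.ofError (y t) := by
      funext t
      rw [ofError_eq, hy, sub_add_cancel]
    have hy0 : y 0 = x₀ := by
      simp only [hy, hx0, ofError_eq, add_sub_cancel_right]
    have hysol := isSolution_iff.1 (hxy ▸ hx)
    have hbound := hall y hysol hy0
    have hJ : ∀ t, 0 ≤ t → |P.J (P.param a ω x t) - (P.Jmin + 1 / 2 * (μ₀ ^ 2 * D))|
        ≤ (C₁ + κ) * (1 / ω + a + δ) := by
      intro t ht
      set u : Vec n := ((y t).1 - μ • w) + dither a P.freq (ω * t) with hu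
      have hua : ‖u‖ ≤ r * a := by
        have h1 : ‖(y t).1 - μ • w‖ ≤ a := (norm_fst_le (y t - xe)).trans (hbound t ht)
        have h2 := norm_dither_le ha.le P.freq (ω * t)
        calc ‖u‖ ≤ a + √n * a := (norm_add_le _ _).trans (add_le_add h1 h2)
          _ = r * a := by rw [hr]; ring
      have hparam : P.param a ω x t = μ • w + P.θmin + u := by
        have h1 : (x t).1 = (y t).1 + P.θmin := by rw [hy]; simp
        rw [param, h1, dither_scaledFreq, hu]
        abel
      have h1 := abs_J_sub_le hH hw hwD hμ.le hua
      rw [← hparam] at h1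
      have h2 : μ * ‖P.h₁‖ * (r * a) + 1 / 2 * ‖P.hess‖ * (r * a) ^ 2 ≤ C₁ * a := by
        have h3 : μ * ‖P.h₁‖ * (r * a) ≤ (1 + b) * ‖P.h₁‖ * (r * a) := by gcongr
        have h4 : 1 / 2 * ‖P.hess‖ * r ^ 2 * a * a ≤ 1 / 2 * ‖P.hess‖ * r ^ 2 * A * a := by gcongr
        rw [hC₁]
        linarith
      have h5 : |(P.Jmin + 1 / 2 * (μ ^ 2 * D)) - (P.Jmin + 1 / 2 * (μ₀ ^ 2 * D))| ≤ κ * δ := by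
        have e : (P.Jmin + 1 / 2 * (μ ^ 2 * D)) - (P.Jmin + 1 / 2 * (μ₀ ^ 2 * D))
            = (μ ^ 2 - μ₀ ^ 2) * (D / 2) := by ring
        rw [e, abs_mul, abs_of_pos (half_pos hD)]
        calc |μ ^ 2 - μ₀ ^ 2| * (D / 2) ≤ 2 * (δ * κ) / D * (D / 2) := by gcongr
          _ = κ * δ := by field_simp
      have h6 := abs_sub_le (P.J (P.param a ω x t)) (P.Jmin + 1 / 2 * (μ ^ 2 * D))
        (P.Jmin + 1 / 2 * (μ₀ ^ 2 * D))
      have h7 : 0 < 1 / ω := by positivity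
      have h8 : 0 ≤ (C₁ + κ) * (1 / ω) + C₁ * δ + κ * a := by positivity
      linarith
    exact isBoundedUnder_abs_and_abs_limsup_sub_le
      ((eventually_ge_atTop 0).mono fun t ht => hJ t ht)
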